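/- Let $d\ge 2$ and $k>d$. For a linear map $L:\mathbb{R}^d\to\mathbb{R}^{k-d}$ let $E=\{(x,L(x)) : x\in\mathbb{R}^d\}\subset\mathbb{R}^k$ be its graph, let $F_\rho=\{0\}^d\times\mathbb{R}^{k-d}$, and let $\rho$ be the projection of $\mathbb{R}^k$ onto $E$ along $F_\rho$. Let $F_\pi$ be a linear complement of $E$ in $\mathbb{R}^k$, and let $\pi,\pi^*$ be the projections onto $E$ and $F_\pi$ given by $\mathbb{R}^k=E+F_\pi$; assume that $\pi$ is injective on $\mathbb{Z}^k$. Put $\mathcal{S}=\pi^*(\{0\}^d\times[0,1]^{k-d})+E$ and, for $s\in\mathbb{R}^k$, let $Y_s=\pi(\mathcal{S}\cap(\mathbb{Z}^k+s))$ be the cubical cut and project set; $s$ and $Y_s$ are regular if $\partial\mathcal{S}\cap(\mathbb{Z}^k+s)=\emptyset$. For $y\in Y_s$ let $\tilde y$ be the unique point of $\mathbb{Z}^k+s$ with $\pi(\tilde y)=y$. For $r>0$ and a bounded convex set $\Omega\subset E$ that contains a neighbourhood of the origin in $E$, the patches of type I and of type II at $y\in Y=Y_s$ are $$P_{\mathrm{I}}(y,r\Omega)=\{y'\in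 Y : y'-y\in r\Omega\},\qquad P_{\mathrm{II}}(y,r\Omega)=\{y'\in Y : \rho(\tilde y'-\tilde y)\in r\Omega\}.$$ Two patches of the same type, at $y_1$ and at $y_2$, are equivalent if $P(y_1,r\Omega)-y_1=P(y_2,r\Omega)-y_2$. The equivalence class of the patch at $y$ is denoted by $\mathcal{P}(y,r\Omega)$; patches of different regular sets $Y_s$ are compared in the same way. For a class $\mathcal{P}$, a point $y\in Y$, a real $R>0$ and a bounded set $A\subset E$ put $$\xi_{\mathcal P}(y,R)=\frac{\#\{y'\in Y : \mathcal{P}(y',r\Omega)=\mathcal{P},\ \tilde y'-\tilde y\in[-R,R]^d\times\mathbb{R}^{k-d}\}}{\#\{y'\in Y : \tilde y'-\tilde y\in[-R,R]^d\times\mathbb{R}^{k-d}\}},\qquad \xi_{\mathcal P}(y,A)=\frac{\#\{y'\in Y : \mathcal{P}(y',r\Omega)=\mathcal{P},\ \tilde y'-\tilde y\in A+F_\rho\}}{\#\{y'\in Y : \tilde y'-\tilde y\in A+F_\rho\}}.$$ Let $A_d\subset\mathbb{R}^d$ be the set of the vectors of the first $d$ coordinates of the points of $A$, let $X_A=\mathbb{Z}^d\cap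 A_d$, and let $H=\bigcup_{n\in X_A}([-\tfrac12,\tfrac12]^d+n)$. Write $|\partial H|$ for the $(d-1)$-dimensional Hausdorff measure of the boundary of $H$. Then for Lebesgue almost every $L$ (identified with its matrix in $\mathbb{R}^{(k-d)\times d}$) and for every $F_\pi$ as above the following holds. For every class $\mathcal{P}$ of patches of type I or II that occurs in some regular $Y_s$, the frequency $\xi_{\mathcal P}=\lim_{R\to\infty}\xi_{\mathcal P}(y,R)$ exists and is the same for all regular $Y_s$ and all $y\in Y_s$, and there is a constant $C$, which depends only on $L$, $F_\pi$ and $\mathcal{P}$ (including its type, $\Omega$ and $r$), such that $$|\xi_{\mathcal P}(y,A)-\xi_{\mathcal P}|\le C\,\frac{|\partial H|}{\#X_A}$$ for all regular $Y_s$, all $y\in Y_s$ and all bounded $A\subset E$ with $X_A\ne\emptyset$. For patches of type II the constant $C$ can be chosen to depend only on $L$ and $F_\pi$, that is, independently of $\mathcal{P}$, $\Omega$ and $r$. -/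

import Mathlib

open MeasureTheory Set Filter Topology
open scoped Pointwise

noncomputable section

/-- The total space `ℝ^k`, with `k = d + m`, written as `ℝ^d × ℝ^m`. Only its linear structure, its
topology and its bounded sets are used. -/
abbrev TotalSpace (d m : ℕ) : Type := (Fin d → ℝ) × (Fin m → ℝ)

/-- The linear map `L : ℝ^d → ℝ^m` with coefficients `α`, that is `L(x)_i = ∑ j, α i j * x j`. -/
def linMap {d m : ℕ} (α : Fin m → Fin d → ℝ) : (Fin d → ℝ) →ₗ[ℝ] (Fin m → ℝ) :=
  Matrix.mulVecLin (Matrix.of α)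

/-- The physical space `E`, the graph of `L`. -/
def physicalSpace {d m : ℕ} (L : (Fin d → ℝ) →ₗ[ℝ] (Fin m → ℝ)) : Submodule ℝ (TotalSpace d m) :=
  L.graph

/-- The reference space `F_ρ = {0}^d × ℝ^m`. -/
def referenceSpace (d m : ℕ) : Submodule ℝ (TotalSpace d m) := Submodule.prod ⊥ ⊤

/-- The integer lattice `ℤ^k`. -/
def integerLattice (d m : ℕ) : Set (TotalSpace d m) :=
  {x | (∀ i, ∃ n : ℤ, x.1 i = n) ∧ ∀ j, ∃ n : ℤ, x.2 j = n}

/-- The translated lattice `ℤ^k + s`. -/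
def shiftedLattice {d m : ℕ} (s : TotalSpace d m) : Set (TotalSpace d m) :=
  (fun x => x + s) '' integerLattice d m

/-- The face `{0}^d × [0,1]^m` of the unit cube. -/
def unitFace (d m : ℕ) : Set (TotalSpace d m) := {x | x.1 = 0 ∧ ∀ j, x.2 j ∈ Icc (0 : ℝ) 1}

theorem isCompl_physicalSpace_referenceSpace {d m : ℕ} (L : (Fin d → ℝ) →ₗ[ℝ] (Fin m → ℝ)) :
    IsCompl (physicalSpace L) (referenceSpace d m) := by
  refine IsCompl.of_eq ?_ ?_
  · refine (Submodule.eq_bot_iff _).2 ?_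
    rintro ⟨x, z⟩ ⟨hx, hz⟩
    have hz1 : x = 0 := by simpa [referenceSpace] using hz
    have hx1 : z = L x := by simpa [physicalSpace] using hx
    simp [hx1, hz1]
  · refine (Submodule.eq_top_iff').2 ?_
    rintro ⟨x, z⟩
    refine Submodule.mem_sup.2 ⟨(x, L x), ?_, (0, z - L x), ?_, ?_⟩
    · simp [physicalSpace]
    · simp [referenceSpace]
    · simp

/-- The projection `ρ` of the total space onto `E` along the reference space `F_ρ`. -/
def rhoProj {d m : ℕ} (L : (Fin d → ℝ) →ₗ[ℝ] (Fin m → ℝ)) : TotalSpace d m →ₗ[ℝ] TotalSpace d m :=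
  (physicalSpace L).projection (referenceSpace d m) (isCompl_physicalSpace_referenceSpace L)

/-- The choice of an internal space `F_π` for the physical space `E = graph L`: a complement of `E`
such that the projection `π` onto `E` along `F_π` is injective on `ℤ^k`. -/
structure CubicalScheme {d m : ℕ} (L : (Fin d → ℝ) →ₗ[ℝ] (Fin m → ℝ)) where
  internalSpace : Submodule ℝ (TotalSpace d m)
  isCompl : IsCompl (physicalSpace L) internalSpace
  injOn : InjOn ((physicalSpace L).projection internalSpace isCompl) (integerLattice d m)

/-- The two notions of patch. -/
inductive PatchType
  | typeI
  | typeII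

namespace CubicalScheme

variable {d m : ℕ} {L : (Fin d → ℝ) →ₗ[ℝ] (Fin m → ℝ)} (S : CubicalScheme L)

/-- The projection `π` onto `E` along `F_π`. -/
def proj : TotalSpace d m →ₗ[ℝ] TotalSpace d m :=
  (physicalSpace L).projection S.internalSpace S.isCompl

/-- The complementary projection `π*` onto `F_π` along `E`. -/
def projStar : TotalSpace d m →ₗ[ℝ] TotalSpace d m :=
  S.internalSpace.projection (physicalSpace L) S.isCompl.symm

/-- The cubical window in `F_π`. -/
def window : Set (TotalSpace d m) := S.projStar '' unitFace d m

/-- The slice `W_π + E`. -/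
def slice : Set (TotalSpace d m) := S.window + (physicalSpace L : Set (TotalSpace d m))

/-- The cubical cut and project set `Y_s`. -/
def cutProject (s : TotalSpace d m) : Set (TotalSpace d m) :=
  S.proj '' (S.slice ∩ shiftedLattice s)

/-- `s` (and `Y_s`) is regular. -/
def IsRegular (s : TotalSpace d m) : Prop := frontier S.slice ∩ shiftedLattice s = ∅

/-- For `y ∈ Y_s`, the unique point of `ℤ^k + s` that `π` maps to `y`. -/
def lift (s y : TotalSpace d m) : TotalSpace d m :=
  Function.invFunOn S.proj (shiftedLattice s) y

/-- The patches of type I and II of shape `Ω` and size `r` at the point `y` of `Y_s`. -/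
def patch (s : TotalSpace d m) : PatchType → Set (TotalSpace d m) → ℝ → TotalSpace d m →
    Set (TotalSpace d m)
  | .typeI, Ω, r, y => {y' ∈ S.cutProject s | y' - y ∈ r • Ω}
  | .typeII, Ω, r, y => {y' ∈ S.cutProject s | rhoProj L (S.lift s y' - S.lift s y) ∈ r • Ω}

/-- The equivalence class of the patch at `y`. Patches at `y₁` and `y₂` are equivalent when
`P(y₁) - y₁ = P(y₂) - y₂`, so the class is recorded by the set `P(y) - y`. -/
def patchClass (s : TotalSpace d m) (t : PatchType) (Ω : Set (TotalSpace d m)) (r : ℝ)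
    (y : TotalSpace d m) : Set (TotalSpace d m) :=
  (fun y' => y' - y) '' S.patch s t Ω r y

/-- The equivalence classes of patches that occur in the regular cut and project sets of the
scheme. -/
def patchClasses (t : PatchType) (Ω : Set (TotalSpace d m)) (r : ℝ) :
    Set (Set (TotalSpace d m)) :=
  {P | ∃ s, S.IsRegular s ∧ ∃ y ∈ S.cutProject s, S.patchClass s t Ω r y = P}

/-- Among the points `y'` of `Y_s` whose lift differs from that of `y` by an element of `B`, the
proportion of those whose patch belongs to the class `P`. -/
def patchRatio (s : TotalSpace d m) (t : PatchType) (Ω : Set (TotalSpace d m)) (r : ℝ)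
    (P : Set (TotalSpace d m)) (y : TotalSpace d m) (B : Set (TotalSpace d m)) : ℝ :=
  ({y' ∈ S.cutProject s | S.patchClass s t Ω r y' = P ∧ S.lift s y' - S.lift s y ∈ B}.ncard : ℝ) /
    ({y' ∈ S.cutProject s | S.lift s y' - S.lift s y ∈ B}.ncard : ℝ)

/-- `ξ_P(y, R)`: the search set is `[-R,R]^d × ℝ^m`. -/
def freqBox (s : TotalSpace d m) (t : PatchType) (Ω : Set (TotalSpace d m)) (r : ℝ)
    (P : Set (TotalSpace d m)) (y : TotalSpace d m) (R : ℝ) : ℝ :=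
  S.patchRatio s t Ω r P y {x | ∀ i, x.1 i ∈ Icc (-R) R}

/-- `ξ_P(y, A)` for a search region `A ⊆ E`: the search set is `A + F_ρ`. -/
def freqRegion (s : TotalSpace d m) (t : PatchType) (Ω : Set (TotalSpace d m)) (r : ℝ)
    (P : Set (TotalSpace d m)) (y : TotalSpace d m) (A : Set (TotalSpace d m)) : ℝ :=
  S.patchRatio s t Ω r P y (A + (referenceSpace d m : Set (TotalSpace d m)))

/-- `ξ` is the asymptotic frequency `ξ_P`: the limit of `ξ_P(y, R)` as `R → ∞`, which exists and is
the same for all regular `s` and all `y ∈ Y_s`. -/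
def IsFrequency (t : PatchType) (Ω : Set (TotalSpace d m)) (r : ℝ) (P : Set (TotalSpace d m))
    (ξ : ℝ) : Prop :=
  ∀ s, S.IsRegular s → ∀ y ∈ S.cutProject s,
    Tendsto (fun R : ℝ => S.freqBox s t Ω r P y R) atTop (𝓝 ξ)

end CubicalScheme

/-- A patch shape: a bounded convex subset of `E` that contains a neighbourhood of the origin
in `E`. -/
def IsPatchShape {d m : ℕ} (L : (Fin d → ℝ) →ₗ[ℝ] (Fin m → ℝ)) (Ω : Set (TotalSpace d m)) : Prop :=
  Ω ⊆ (physicalSpace L : Set (TotalSpace d m)) ∧ Bornology.IsBounded Ω ∧ Convex ℝ Ω ∧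
    Ω ∈ 𝓝[(physicalSpace L : Set (TotalSpace d m))] (0 : TotalSpace d m)

/-- `X_A`: the integer points in the canonical projection of `A` to `ℝ^d`. -/
def searchPoints {d m : ℕ} (A : Set (TotalSpace d m)) : Set (Fin d → ℤ) :=
  {n | (fun i => (n i : ℝ)) ∈ Prod.fst '' A}

/-- The union of the cubes `[-1/2, 1/2]^d + n` over the points `n` of `X`. -/
def cubeComplex {d : ℕ} (X : Set (Fin d → ℤ)) : Set (EuclideanSpace ℝ (Fin d)) :=
  ⋃ n ∈ X, {x | ∀ i, |x i - (n i : ℝ)| ≤ 1 / 2}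

/-- The `(d-1)`-dimensional measure of the boundary of a subset of Euclidean space `ℝ^d`, by the
Hausdorff measure normalised so that a unit `(d-1)`-cube has measure `1`. -/
def boundaryArea {d : ℕ} (H : Set (EuclideanSpace ℝ (Fin d))) : ℝ :=
  ((Measure.euclideanHausdorffMeasure (d - 1) : Measure (EuclideanSpace ℝ (Fin d)))
    (frontier H)).toReal

end

/-! A regular `Y_s` has exactly one point over each `n` in `ℤ^d`, and the height of its lift in the
window is the vector of fractional parts of `w - L n`, with `w` depending only on `L` and `s`. So
`Y_s` is an orbit of a translation action of `ℤ^d` on the torus (`slice_inter_shiftedLattice`,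
`slicePoint_add_sub`). The slice itself does not depend on `F_π` (`mem_slice`), which is why one
null set of `L` serves all `F_π`. The class of the patch at a point is a function of its height, and
the heights that give a fixed class form a finite disjoint union of boxes
(`exists_boxes_of_windowClass`). Hence `ξ_P(y, A)` is an average over `X_A` of visits of an orbit to
boxes, the frequency is the total volume of the boxes, and the theorem becomes a discrepancy
estimate: over any finite `X`, the visits to a box differ from `#X` times its volume by at most a
constant times the boundary of `X`, uniformly in box and orbit (`ae_exists_discrepancy_le`). For
type II there is at most one box, so the constant does not see the patch.

On cubes of side `N` the discrepancy is `O(N^(d - 3/2))` for almost every `L`. The indicator of a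
box has a product majorant with Fourier coefficients controlled by `|k|^(-(1+θ))` in each coordinate
(`exists_fourier_majorant`). The exponential sums over the cube are bounded by `N^(θ d)` times
products of `|e(x) - 1|^(-(1-θ))`, which are locally integrable in `L`, so their weighted sum over
the frequencies is finite almost everywhere (`ae_exists_sum_norm_unitExp_le`). Cutting the torus
into `3^m` boxes turns upper bounds into two-sided ones (`abs_sum_boxVisit_sub_le`).

From cubes to arbitrary `X` the passage is dyadic. Each dyadic cube is rounded to full or empty by
majority vote. When the vote of a cube differs from that of its parent, a discrete isoperimetric
inequality (`card_mul_card_le_cutEdges`) forces at least a constant times `N^(d-1)` boundary edges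
of `X` in the parent. The cube discrepancy at that scale is smaller than `N^(d-1)` by a factor
`N^(-1/2)`, so the scales sum as a geometric series (`abs_sum_inter_sub_le`). Finally, boundary
edges correspond to disjoint unit faces in `∂H` (`card_cutEdges_le_boundaryArea`). -/

noncomputable section

/-! ### Discrete isoperimetry in a cube of `ℤ^d` -/

section Grid

variable {ι : Type*} [Fintype ι] [DecidableEq ι]

/-- The cube of side `N` in `ℤ^ι` with lower corner `a`. -/
def gridCube (a : ι → ℤ) (N : ℕ) : Finset (ι → ℤ) :=
  Fintype.piFinset fun i => Finset.Ico (a i) (a i + N)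

/-- The pairs `(i, n)` for which the edge from `n` to `n + e_i` lies in `Q` and joins a point of `X`
to a point outside of `X`. -/
def cutEdges (Q X : Finset (ι → ℤ)) : Finset (ι × (ι → ℤ)) :=
  (Finset.univ ×ˢ Q).filter fun p =>
    p.2 + Pi.single p.1 1 ∈ Q ∧ (p.2 ∈ X ↔ p.2 + Pi.single p.1 1 ∉ X)

theorem mem_gridCube {a : ι → ℤ} {N : ℕ} {n : ι → ℤ} :
    n ∈ gridCube a N ↔ ∀ i, a i ≤ n i ∧ n i < a i + N := by
  simp [gridCube]

theorem card_gridCube (a : ι → ℤ) (N : ℕ) : (gridCube a N).card = N ^ Fintype.card ι := by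
  simp [gridCube, Fintype.card_piFinset]

theorem abs_sub_le_sum_jumps (φ : ℤ → ℝ) (a b : ℤ) {u v : ℤ} (hu : u ∈ Finset.Ico a b)
    (hv : v ∈ Finset.Ico a b) :
    |φ u - φ v| ≤ ∑ τ ∈ Finset.Ico a b, if τ + 1 < b then |φ τ - φ (τ + 1)| else 0 := by
  wlog h : u ≤ v generalizing u v
  · rw [abs_sub_comm]
    exact this hv hu (by omega)
  rw [Finset.mem_Ico] at hu hv
  have key : ∀ v, u ≤ v → |φ u - φ v| ≤ ∑ τ ∈ Finset.Ico u v, |φ τ - φ (τ + 1)| := by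
    intro v hv
    induction v, hv using Int.leInduction with
    | base => simp
    | succ n hn ih =>
      rw [← Finset.insert_Ico_right_eq_Ico_add_one hn, Finset.sum_insert (by simp)]
      have := abs_sub_le (φ u) (φ n) (φ (n + 1))
      linarith
  refine (key v h).trans ?_
  calc _ = ∑ τ ∈ Finset.Ico u v, if τ + 1 < b then |φ τ - φ (τ + 1)| else 0 :=
        Finset.sum_congr rfl fun τ hτ => by
          rw [Finset.mem_Ico] at hτ
          rw [if_pos (by omega)]
    _ ≤ _ := Finset.sum_le_sum_of_subset_of_nonneg
        (Finset.Ico_subset_Ico (by omega) (by omega)) fun τ _ _ => by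
          split_ifs <;> positivity

theorem update_mem_gridCube {a : ι → ℤ} {N : ℕ} {x : ι → ℤ} (hx : x ∈ gridCube a N) (i : ι) {t : ℤ}
    (ht : t ∈ Finset.Ico (a i) (a i + N)) : Function.update x i t ∈ gridCube a N := by
  rw [mem_gridCube] at *
  rw [Finset.mem_Ico] at ht
  intro j
  by_cases h : j = i
  · subst h; simpa using ht
  · simpa [h] using hx j

/-- Exchanging the coordinate `x i` with `t` is an involution of the pairs `(x, t)`; after it `t` is
a free variable with `N` values. -/
theorem sum_gridCube_update (a : ι → ℤ) (N : ℕ) (i : ι) (g : (ι → ℤ) → ℝ) :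
    ∑ x ∈ gridCube a N, ∑ t ∈ Finset.Ico (a i) (a i + N), g (Function.update x i t) =
      N * ∑ x ∈ gridCube a N, g x := by
  have : ∑ p ∈ gridCube a N ×ˢ Finset.Ico (a i) (a i + N), g (Function.update p.1 i p.2) =
      ∑ p ∈ gridCube a N ×ˢ Finset.Ico (a i) (a i + N), g p.1 := by
    refine Finset.sum_bij' (fun p _ => (Function.update p.1 i p.2, p.1 i))
      (fun p _ => (Function.update p.1 i p.2, p.1 i)) ?_ ?_ ?_ ?_ ?_
    · rintro ⟨x, t⟩ h
      rw [Finset.mem_product] at h ⊢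
      exact ⟨update_mem_gridCube h.1 i h.2, Finset.mem_Ico.2 (mem_gridCube.1 h.1 i)⟩
    · rintro ⟨x, t⟩ h
      rw [Finset.mem_product] at h ⊢
      exact ⟨update_mem_gridCube h.1 i h.2, Finset.mem_Ico.2 (mem_gridCube.1 h.1 i)⟩
    · rintro ⟨x, t⟩ _; simp
    · rintro ⟨x, t⟩ _; simp
    · rintro ⟨x, t⟩ _; rfl
  rw [Finset.sum_product, Finset.sum_product] at this
  rw [this]
  simp [Finset.mul_sum]

/-- Telescoping bounds each difference by all the jumps on the line through `x` in direction `i`.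
Each jump is then counted `N` times by the points of its line and `N ^ card ι` times by the choices
of `y`. -/
theorem sum_abs_sub_update_le (a : ι → ℤ) (N : ℕ) (i : ι) (f : (ι → ℤ) → ℝ) :
    ∑ x ∈ gridCube a N, ∑ y ∈ gridCube a N, |f x - f (Function.update x i (y i))| ≤
      N ^ (Fintype.card ι + 1) * ∑ n ∈ gridCube a N,
        if n + Pi.single i 1 ∈ gridCube a N then |f n - f (n + Pi.single i 1)| else 0 := by
  set g : (ι → ℤ) → ℝ := fun n =>
    if n + Pi.single i 1 ∈ gridCube a N then |f n - f (n + Pi.single i 1)| else 0 with hg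
  have h1 : ∀ x ∈ gridCube a N, ∀ y ∈ gridCube a N, |f x - f (Function.update x i (y i))| ≤
      ∑ t ∈ Finset.Ico (a i) (a i + N), g (Function.update x i t) := by
    intro x hx y hy
    have := abs_sub_le_sum_jumps (fun t => f (Function.update x i t)) (a i) (a i + N)
      (Finset.mem_Ico.2 (mem_gridCube.1 hx i)) (Finset.mem_Ico.2 (mem_gridCube.1 hy i))
    simp only [Function.update_eq_self] at this
    refine this.trans (Finset.sum_le_sum fun t ht => ?_)
    have he : Function.update x i t + Pi.single i 1 = Function.update x i (t + 1) := by
      ext j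
      by_cases h : j = i
      · subst h; simp
      · simp [h]
    split_ifs with h
    · rw [Finset.mem_Ico] at ht
      simp only [hg, he]
      rw [if_pos (update_mem_gridCube hx i (Finset.mem_Ico.2 ⟨by omega, h⟩))]
    · simp only [hg]
      split_ifs <;> positivity
  calc _ ≤ ∑ x ∈ gridCube a N, ∑ y ∈ gridCube a N,
        ∑ t ∈ Finset.Ico (a i) (a i + N), g (Function.update x i t) :=
        Finset.sum_le_sum fun x hx => Finset.sum_le_sum fun y hy => h1 x hx y hy
    _ = N ^ Fintype.card ι * ∑ x ∈ gridCube a N,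
        ∑ t ∈ Finset.Ico (a i) (a i + N), g (Function.update x i t) := by
        simp [Finset.mul_sum, card_gridCube]
    _ = _ := by rw [sum_gridCube_update]; ring

/-- An `L¹` Poincaré inequality: `x` is turned into `y` one coordinate at a time, through the points
`s.piecewise y x`. -/
theorem sum_abs_sub_le (a : ι → ℤ) (N : ℕ) (f : (ι → ℤ) → ℝ) :
    ∑ x ∈ gridCube a N, ∑ y ∈ gridCube a N, |f x - f y| ≤
      N ^ (Fintype.card ι + 1) * ∑ i, ∑ n ∈ gridCube a N,
        if n + Pi.single i 1 ∈ gridCube a N then |f n - f (n + Pi.single i 1)| else 0 := by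
  have key : ∀ s : Finset ι,
      ∑ x ∈ gridCube a N, ∑ y ∈ gridCube a N, |f x - f (s.piecewise y x)| ≤
      N ^ (Fintype.card ι + 1) * ∑ i ∈ s, ∑ n ∈ gridCube a N,
        if n + Pi.single i 1 ∈ gridCube a N then |f n - f (n + Pi.single i 1)| else 0 := by
    intro s
    induction s using Finset.induction_on with
    | empty => simp
    | insert i s hi ih =>
      rw [Finset.sum_insert hi, mul_add]
      -- Swapping the coordinates in `s` between `x` and `y` permutes the pairs and turns the step
      -- that adds `i` into a change of that single coordinate.
      have hs : ∑ x ∈ gridCube a N, ∑ y ∈ gridCube a N,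
          |f (s.piecewise y x) - f ((insert i s).piecewise y x)| =
          ∑ x ∈ gridCube a N, ∑ y ∈ gridCube a N, |f x - f (Function.update x i (y i))| := by
        rw [← Finset.sum_product', ← Finset.sum_product']
        refine Finset.sum_bij' (fun p _ => (s.piecewise p.2 p.1, s.piecewise p.1 p.2))
          (fun p _ => (s.piecewise p.2 p.1, s.piecewise p.1 p.2)) ?_ ?_ ?_ ?_ ?_
        · rintro ⟨x, y⟩ h
          simp only [Finset.mem_product, mem_gridCube] at h ⊢
          constructor <;> intro j <;> by_cases hj : j ∈ s <;> simp [hj, h.1 j, h.2 j]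
        · rintro ⟨x, y⟩ h
          simp only [Finset.mem_product, mem_gridCube] at h ⊢
          constructor <;> intro j <;> by_cases hj : j ∈ s <;> simp [hj, h.1 j, h.2 j]
        · rintro ⟨x, y⟩ _
          ext j <;> by_cases hj : j ∈ s <;> simp [hj]
        · rintro ⟨x, y⟩ _
          ext j <;> by_cases hj : j ∈ s <;> simp [hj]
        · rintro ⟨x, y⟩ _
          simp [Finset.piecewise_insert, hi]
      have ht := sum_abs_sub_update_le a N i f
      rw [← hs] at ht
      refine le_trans ?_ (add_le_add ht ih)
      rw [← Finset.sum_add_distrib]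
      refine Finset.sum_le_sum fun x _ => ?_
      rw [← Finset.sum_add_distrib]
      refine Finset.sum_le_sum fun y _ => ?_
      have := abs_sub_le (f x) (f (s.piecewise y x)) (f ((insert i s).piecewise y x))
      linarith
  simpa using key Finset.univ

/-- A discrete isoperimetric inequality in a cube. -/
theorem card_mul_card_le_cutEdges (a : ι → ℤ) (N : ℕ) (X : Finset (ι → ℤ)) :
    ((gridCube a N ∩ X).card : ℝ) * (gridCube a N \ X).card ≤
      N ^ (Fintype.card ι + 1) * (cutEdges (gridCube a N) X).card := by
  set f : (ι → ℤ) → ℝ := fun n => if n ∈ X then 1 else 0 with hf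
  have h := sum_abs_sub_le a N f
  have h1 : (∑ i, ∑ n ∈ gridCube a N,
      if n + Pi.single i 1 ∈ gridCube a N then |f n - f (n + Pi.single i 1)| else 0) =
      (cutEdges (gridCube a N) X).card := by
    rw [cutEdges, ← Finset.sum_product', Finset.card_filter, Nat.cast_sum]
    refine Finset.sum_congr rfl ?_
    rintro ⟨i, n⟩ _
    by_cases h1 : n + Pi.single i 1 ∈ gridCube a N <;> by_cases h2 : n ∈ X <;>
      by_cases h3 : n + Pi.single i 1 ∈ X <;> simp [hf, h1, h2, h3]
  rw [h1] at h
  refine le_trans ?_ h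
  calc ((gridCube a N ∩ X).card : ℝ) * (gridCube a N \ X).card
      = ∑ x ∈ gridCube a N ∩ X, ∑ y ∈ gridCube a N \ X, |f x - f y| := by
        rw [Finset.sum_congr rfl (g := fun _ => ((gridCube a N \ X).card : ℝ))]
        · simp
        intro x hx
        rw [Finset.sum_congr rfl (g := fun _ => (1 : ℝ))]
        · simp
        intro y hy
        simp [hf, (Finset.mem_inter.1 hx).2, (Finset.mem_sdiff.1 hy).2]
    _ ≤ ∑ x ∈ gridCube a N ∩ X, ∑ y ∈ gridCube a N, |f x - f y| :=
        Finset.sum_le_sum fun x _ => Finset.sum_le_sum_of_subset_of_nonneg Finset.sdiff_subset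
          fun _ _ _ => abs_nonneg _
    _ ≤ _ := Finset.sum_le_sum_of_subset_of_nonneg Finset.inter_subset_left
          fun _ _ _ => Finset.sum_nonneg fun _ _ => abs_nonneg _

end Grid

/-! ### From dyadic cubes to arbitrary finite sets -/

section Dyadic

variable {ι : Type*} [Fintype ι] [DecidableEq ι]

theorem mem_gridCube_two_mul_iff {a : ι → ℤ} {N : ℕ} (hN : 0 < N) {n : ι → ℤ} :
    n ∈ gridCube a (2 * N) ↔ (fun i => (n i - a i) / (N : ℤ)) ∈ gridCube (0 : ι → ℤ) 2 := by
  have hN' : (0 : ℤ) < N := by exact_mod_cast hN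
  simp only [mem_gridCube]
  refine forall_congr' fun i => ?_
  have h1 := Int.ediv_mul_le (n i - a i) hN'.ne'
  have h2 := Int.lt_ediv_add_one_mul_self (n i - a i) hN'
  simp only [Pi.zero_apply]
  rw [Int.le_ediv_iff_mul_le hN', Int.ediv_lt_iff_lt_mul hN']
  push_cast
  constructor <;> rintro ⟨h3, h4⟩ <;> constructor <;> linarith

theorem mem_gridCube_child_iff {a : ι → ℤ} {N : ℕ} (hN : 0 < N) {n ε : ι → ℤ} :
    n ∈ gridCube (fun i => a i + N * ε i) N ↔ (fun i => (n i - a i) / (N : ℤ)) = ε := by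
  have hN' : (0 : ℤ) < N := by exact_mod_cast hN
  rw [mem_gridCube, funext_iff]
  refine forall_congr' fun i => ?_
  rw [Int.ediv_eq_iff_of_pos hN']
  constructor <;> rintro ⟨h3, h4⟩ <;> constructor <;> linarith

theorem gridCube_child_subset {a : ι → ℤ} {N : ℕ} (hN : 0 < N) {ε : ι → ℤ}
    (hε : ε ∈ gridCube (0 : ι → ℤ) 2) :
    gridCube (fun i => a i + N * ε i) N ⊆ gridCube a (2 * N) := by
  intro n hn
  rw [mem_gridCube_child_iff hN] at hn
  rw [mem_gridCube_two_mul_iff hN, hn]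
  exact hε

theorem sum_gridCube_two_mul (a : ι → ℤ) {N : ℕ} (hN : 0 < N) (F : (ι → ℤ) → ℝ) :
    ∑ n ∈ gridCube a (2 * N), F n =
      ∑ ε ∈ gridCube (0 : ι → ℤ) 2, ∑ n ∈ gridCube (fun i => a i + N * ε i) N, F n := by
  rw [← Finset.sum_fiberwise_of_maps_to (s := gridCube a (2 * N)) (t := gridCube (0 : ι → ℤ) 2)
    (g := fun n i => (n i - a i) / (N : ℤ)) (fun n hn => (mem_gridCube_two_mul_iff hN).1 hn)]
  refine Finset.sum_congr rfl fun ε hε => Finset.sum_congr ?_ fun _ _ => rfl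
  ext n
  rw [Finset.mem_filter, mem_gridCube_child_iff hN]
  refine ⟨fun h => h.2, fun h => ⟨?_, h⟩⟩
  rw [mem_gridCube_two_mul_iff hN, h]
  exact hε

/-- An edge inside a child is an edge inside the parent, and its starting point determines the
child; the edges between children are simply dropped. -/
theorem sum_card_cutEdges_child_le (a : ι → ℤ) {N : ℕ} (hN : 0 < N) (X : Finset (ι → ℤ)) :
    ∑ ε ∈ gridCube (0 : ι → ℤ) 2, (cutEdges (gridCube (fun i => a i + N * ε i) N) X).card ≤
      (cutEdges (gridCube a (2 * N)) X).card := by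
  rw [Finset.card_eq_sum_card_fiberwise (s := cutEdges (gridCube a (2 * N)) X)
    (t := gridCube (0 : ι → ℤ) 2) (f := fun p i => (p.2 i - a i) / (N : ℤ))]
  · refine Finset.sum_le_sum fun ε hε => Finset.card_le_card fun p hp => ?_
    have hs := gridCube_child_subset (a := a) hN hε
    simp only [cutEdges, Finset.mem_filter, Finset.mem_product] at hp ⊢
    exact ⟨⟨⟨hp.1.1, hs hp.1.2⟩, hs hp.2.1, hp.2.2⟩, (mem_gridCube_child_iff hN).1 hp.1.2⟩
  · intro p hp
    have hp : p ∈ cutEdges (gridCube a (2 * N)) X := hp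
    simp only [cutEdges, Finset.mem_filter, Finset.mem_product] at hp
    exact (mem_gridCube_two_mul_iff hN).1 hp.1.2

/-- At least half of the points of `Q` belong to `X`. -/
def IsMajority (Q X : Finset (ι → ℤ)) : Prop := Q.card ≤ 2 * (Q ∩ X).card

/-- When the votes disagree, one of `X` and its complement fills half of the child and the other
fills half of the parent. Both are then large in the parent, and the isoperimetric inequality
applies there. -/
theorem pow_le_cutEdges_of_majority_change (a : ι → ℤ) {N : ℕ} (hN : 0 < N) (X : Finset (ι → ℤ))
    {ε : ι → ℤ} (hε : ε ∈ gridCube (0 : ι → ℤ) 2)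
    (h : ¬(IsMajority (gridCube (fun i => a i + N * ε i) N) X ↔
      IsMajority (gridCube a (2 * N)) X)) :
    (N : ℝ) ^ Fintype.card ι ≤ 8 * N * (cutEdges (gridCube a (2 * N)) X).card := by
  set d := Fintype.card ι
  have hs := gridCube_child_subset (a := a) hN hε
  set Q := gridCube (fun i => a i + N * ε i) N with hQ
  set Q' := gridCube a (2 * N) with hQ'
  have cQ : Q.card = N ^ d := card_gridCube _ _
  have cQ' : Q'.card = (2 * N) ^ d := card_gridCube _ _
  have e1 := Finset.card_inter_add_card_sdiff Q X
  have e2 := Finset.card_inter_add_card_sdiff Q' X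
  have i1 : (Q ∩ X).card ≤ (Q' ∩ X).card := Finset.card_le_card (Finset.inter_subset_inter_right hs)
  have i2 : (Q \ X).card ≤ (Q' \ X).card := Finset.card_le_card (Finset.sdiff_subset_sdiff hs le_rfl)
  have key := card_mul_card_le_cutEdges a (2 * N) X
  rw [← hQ'] at key
  have h4 : Q.card * Q'.card ≤ 4 * ((Q' ∩ X).card * (Q' \ X).card) := by
    unfold IsMajority at h
    by_cases hm : Q.card ≤ 2 * (Q ∩ X).card
    · have hm' : ¬ Q'.card ≤ 2 * (Q' ∩ X).card := fun hc => h ⟨fun _ => hc, fun _ => hm⟩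
      have : Q'.card ≤ 2 * (Q' \ X).card := by omega
      have h5 : Q.card ≤ 2 * (Q' ∩ X).card := by omega
      calc _ ≤ _ := Nat.mul_le_mul h5 this
        _ = _ := by ring
    · have hm' : Q'.card ≤ 2 * (Q' ∩ X).card := by
        by_contra hc
        exact h ⟨fun h => absurd h hm, fun h => absurd h hc⟩
      have : Q.card ≤ 2 * (Q' \ X).card := by omega
      calc _ ≤ _ := Nat.mul_le_mul this hm'
        _ = _ := by ring
  rw [cQ, cQ'] at h4
  have h5 : ((N : ℝ) ^ d * (2 * N) ^ d) ≤ 4 * ((Q' ∩ X).card * (Q' \ X).card) := by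
    exact_mod_cast h4
  have hN' : (0 : ℝ) < N := by exact_mod_cast hN
  have hp : (0 : ℝ) < (2 * N) ^ d := by positivity
  push_cast at key
  refine le_of_mul_le_mul_right ?_ hp
  calc _ ≤ _ := h5
    _ ≤ 4 * ((2 * (N : ℝ)) ^ (d + 1) * (cutEdges Q' X).card) := by linarith
    _ = _ := by rw [pow_succ]; ring

open Classical in
-- The sum over `X` is compared with its majority rounding. Going up one scale, the errors of the
-- children add up because their cut edges are disjoint. The rounding itself changes only if some
-- child disagrees with the parent, and then the cut edges pay for the sums over all `2^d` children.
theorem abs_sum_inter_sub_le (h : (ι → ℤ) → ℝ) (C r : ℝ) (hr : 0 ≤ r)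
    (hD : ∀ (J : ℕ) (a : ι → ℤ), |∑ n ∈ gridCube a (2 ^ J), h n| * 2 ^ J ≤
      C * (2 ^ J) ^ Fintype.card ι * r ^ J) (X : Finset (ι → ℤ)) (J : ℕ) (a : ι → ℤ) :
    |∑ n ∈ gridCube a (2 ^ J) ∩ X, h n -
        if IsMajority (gridCube a (2 ^ J)) X then ∑ n ∈ gridCube a (2 ^ J), h n else 0| ≤
      (8 * 2 ^ Fintype.card ι * C * ∑ j ∈ Finset.range J, r ^ j) *
        (cutEdges (gridCube a (2 ^ J)) X).card := by
  have hC : 0 ≤ C := by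
    have := hD 0 0
    simp only [pow_zero, mul_one, one_pow] at this
    exact (abs_nonneg _).trans this
  induction J generalizing a with
  | zero =>
    have hQ : gridCube a (2 ^ 0) = {a} := by
      ext n
      simp only [mem_gridCube, Finset.mem_singleton, funext_iff]
      refine forall_congr' fun i => ?_
      simp only [pow_zero, Nat.cast_one]
      omega
    rw [hQ]
    -- The bound is `0` here: on a one-point cube a majority is the same as membership, so the
    -- rounding is exact.
    by_cases ha : a ∈ X <;> simp [ha, IsMajority]
  | succ J ih =>
    set M : ℕ := 2 ^ J with hM
    have hMpos : 0 < M := by positivity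
    have hJ : 2 ^ (J + 1) = 2 * M := by rw [pow_succ, mul_comm]
    rw [hJ]
    set Q' := gridCube a (2 * M) with hQ'
    set Q : (ι → ℤ) → Finset (ι → ℤ) := fun ε => gridCube (fun i => a i + M * ε i) M with hQ
    have s1 : ∑ n ∈ Q' ∩ X, h n = ∑ ε ∈ gridCube (0 : ι → ℤ) 2, ∑ n ∈ Q ε ∩ X, h n := by
      rw [← Finset.sum_ite_mem, sum_gridCube_two_mul a hMpos]
      simp_rw [Finset.sum_ite_mem]
      rfl
    have s2 : ∑ n ∈ Q', h n = ∑ ε ∈ gridCube (0 : ι → ℤ) 2, ∑ n ∈ Q ε, h n :=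
      sum_gridCube_two_mul a hMpos _
    have split : (∑ n ∈ Q' ∩ X, h n - if IsMajority Q' X then ∑ n ∈ Q', h n else 0) =
        ∑ ε ∈ gridCube (0 : ι → ℤ) 2,
          (∑ n ∈ Q ε ∩ X, h n - if IsMajority (Q ε) X then ∑ n ∈ Q ε, h n else 0) +
        ∑ ε ∈ gridCube (0 : ι → ℤ) 2,
          ((if IsMajority (Q ε) X then ∑ n ∈ Q ε, h n else 0) -
            if IsMajority Q' X then ∑ n ∈ Q ε, h n else 0) := by
      rw [← Finset.sum_add_distrib, s1]
      simp only [sub_add_sub_cancel]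
      rw [Finset.sum_sub_distrib]
      congr 1
      split_ifs
      · exact s2
      · simp
    have b1 : |∑ ε ∈ gridCube (0 : ι → ℤ) 2,
          (∑ n ∈ Q ε ∩ X, h n - if IsMajority (Q ε) X then ∑ n ∈ Q ε, h n else 0)| ≤
        (8 * 2 ^ Fintype.card ι * C * ∑ j ∈ Finset.range J, r ^ j) * (cutEdges Q' X).card := by
      refine (Finset.abs_sum_le_sum_abs _ _).trans ?_
      refine (Finset.sum_le_sum fun ε _ => ih _).trans ?_
      rw [← Finset.mul_sum]
      refine mul_le_mul_of_nonneg_left ?_ (by positivity)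
      exact_mod_cast sum_card_cutEdges_child_le a hMpos X
    have b2 : |∑ ε ∈ gridCube (0 : ι → ℤ) 2,
          ((if IsMajority (Q ε) X then ∑ n ∈ Q ε, h n else 0) -
            if IsMajority Q' X then ∑ n ∈ Q ε, h n else 0)| ≤
        8 * 2 ^ Fintype.card ι * C * r ^ J * (cutEdges Q' X).card := by
      -- A single disagreeing child is enough to bound the contributions of all the children,
      -- disagreeing or not.
      by_cases hb : ∀ ε ∈ gridCube (0 : ι → ℤ) 2, (IsMajority (Q ε) X ↔ IsMajority Q' X)
      · rw [Finset.sum_eq_zero]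
        · rw [abs_zero]; positivity
        · intro ε hε
          simp [hb ε hε]
      · push Not at hb
        obtain ⟨ε₀, h₀, hb⟩ := hb
        have hb : ¬(IsMajority (Q ε₀) X ↔ IsMajority Q' X) := by tauto
        have hcut := pow_le_cutEdges_of_majority_change a hMpos X h₀ hb
        have hMr : (0 : ℝ) < M := by exact_mod_cast hMpos
        have hd : ∀ ε, |∑ n ∈ Q ε, h n| * M ≤ C * (M : ℝ) ^ Fintype.card ι * r ^ J := by
          intro ε
          have := hD J (fun i => a i + M * ε i)
          have hMJ : (M : ℝ) = 2 ^ J := by simp [hM]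
          rw [hMJ]
          exact this
        refine le_of_mul_le_mul_right ?_ hMr
        calc _ ≤ (∑ ε ∈ gridCube (0 : ι → ℤ) 2, |∑ n ∈ Q ε, h n|) * M := by
              refine mul_le_mul_of_nonneg_right ?_ hMr.le
              refine (Finset.abs_sum_le_sum_abs _ _).trans (Finset.sum_le_sum fun ε _ => ?_)
              split_ifs <;> simp
          _ ≤ ∑ ε ∈ gridCube (0 : ι → ℤ) 2, C * (M : ℝ) ^ Fintype.card ι * r ^ J := by
              rw [Finset.sum_mul]
              exact Finset.sum_le_sum fun ε _ => hd ε
          _ = 2 ^ Fintype.card ι * C * r ^ J * (M : ℝ) ^ Fintype.card ι := by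
              rw [Finset.sum_const, card_gridCube, nsmul_eq_mul]
              push_cast
              ring
          _ ≤ 2 ^ Fintype.card ι * C * r ^ J * (8 * M * (cutEdges Q' X).card) :=
              mul_le_mul_of_nonneg_left hcut (by positivity)
          _ = _ := by ring
    rw [split]
    refine (abs_add_le _ _).trans ((add_le_add b1 b2).trans (le_of_eq ?_))
    rw [Finset.sum_range_succ]
    ring

theorem exists_abs_sum_le_cutEdges [Nonempty ι] (h : (ι → ℤ) → ℝ) (C r : ℝ) (hr : 0 ≤ r)
    (hr1 : r < 1) (hD : ∀ (J : ℕ) (a : ι → ℤ), |∑ n ∈ gridCube a (2 ^ J), h n| * 2 ^ J ≤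
      C * (2 ^ J) ^ Fintype.card ι * r ^ J) (X : Finset (ι → ℤ)) :
    ∃ Q : Finset (ι → ℤ), |∑ n ∈ X, h n| ≤
      8 * 2 ^ Fintype.card ι * C * (1 - r)⁻¹ * (cutEdges Q X).card := by
  classical
  have hC : 0 ≤ C := by
    have := hD 0 0
    simp only [pow_zero, mul_one, one_pow] at this
    exact (abs_nonneg _).trans this
  obtain ⟨B, hB⟩ : ∃ B : ℕ, ∀ n ∈ X, ∀ i, |n i| ≤ B := by
    refine ⟨∑ n ∈ X, ∑ i, (n i).natAbs, fun n hn i => ?_⟩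
    have h1 : (n i).natAbs ≤ ∑ i, (n i).natAbs :=
      Finset.single_le_sum (f := fun i => (n i).natAbs) (fun _ _ => Nat.zero_le _)
        (Finset.mem_univ i)
    have h2 := Finset.single_le_sum (f := fun n : ι → ℤ => ∑ i, (n i).natAbs)
      (fun _ _ => Nat.zero_le _) hn
    rw [Int.abs_eq_natAbs]
    exact_mod_cast h1.trans h2
  -- With `J < 2 ^ J` the cube is wide enough to contain `X` and large enough for `X` to be a
  -- minority, so the rounded value is `0`.
  set J := 2 * B + 2 * X.card + 1 with hJ
  have hlt : J < 2 ^ J := Nat.lt_two_pow_self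
  have hsub : X ⊆ gridCube (fun _ => -(B : ℤ)) (2 ^ J) := by
    intro n hn
    rw [mem_gridCube]
    intro i
    have h1 := abs_le.1 (hB n hn i)
    have h2 : (J : ℤ) < ((2 ^ J : ℕ) : ℤ) := by exact_mod_cast hlt
    constructor
    · exact h1.1
    · rw [hJ] at h2
      push_cast at h2 ⊢
      linarith [h1.2, (Nat.cast_nonneg X.card : (0 : ℤ) ≤ X.card)]
  refine ⟨gridCube (fun _ => -(B : ℤ)) (2 ^ J), ?_⟩
  have key := abs_sum_inter_sub_le h C r hr hD X J (fun _ => -(B : ℤ))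
  rw [Finset.inter_eq_right.2 hsub, if_neg, sub_zero] at key
  · refine key.trans (mul_le_mul_of_nonneg_right ?_ (by positivity))
    refine mul_le_mul_of_nonneg_left ?_ (by positivity)
    rw [← tsum_geometric_of_lt_one hr hr1]
    exact (summable_geometric_of_lt_one hr hr1).sum_le_tsum _ fun _ _ => by positivity
  · rw [IsMajority, Finset.inter_eq_right.2 hsub, card_gridCube, not_le]
    have h1 : 2 ^ J ≤ (2 ^ J) ^ Fintype.card ι :=
      Nat.le_self_pow Fintype.card_ne_zero _
    omega

end Dyadic

/-! ### Cut edges and the Hausdorff measure of the boundary -/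

section Boundary

variable {e : ℕ}

/-- The closed unit cube centred at `c`. -/
def closedCube {ι : Type*} (c : ι → ℝ) : Set (EuclideanSpace ℝ ι) := {x | ∀ i, |x i - c i| ≤ 1 / 2}

/-- The open unit cube centred at `c`. -/
def openCube {ι : Type*} (c : ι → ℝ) : Set (EuclideanSpace ℝ ι) := {x | ∀ i, |x i - c i| < 1 / 2}

theorem openCube_subset_closedCube {ι : Type*} (c : ι → ℝ) : openCube c ⊆ closedCube c :=
  fun _ hx i => (hx i).le

theorem isClosed_closedCube {ι : Type*} [Fintype ι] (c : ι → ℝ) : IsClosed (closedCube c) := by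
  simp only [closedCube, ofPred_forall]
  exact isClosed_iInter fun i => isClosed_le (by fun_prop) continuous_const

theorem isOpen_openCube {ι : Type*} [Fintype ι] (c : ι → ℝ) : IsOpen (openCube c) := by
  simp only [openCube, ofPred_forall]
  exact isOpen_iInter_of_finite fun i => isOpen_lt (by fun_prop) continuous_const

theorem volume_openCube {ι : Type*} [Fintype ι] (c : ι → ℝ) : volume (openCube c) = 1 := by
  have h : openCube c = (WithLp.ofLp : EuclideanSpace ℝ ι → ι → ℝ) ⁻¹'
      (Set.pi univ fun i => Ioo (c i - 1 / 2) (c i + 1 / 2)) := by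
    ext x
    simp only [openCube, mem_ofPred_eq, mem_preimage, mem_univ_pi, mem_Ioo, abs_lt]
    refine forall_congr' fun i => ?_
    constructor <;> rintro ⟨h1, h2⟩ <;> constructor <;> linarith
  rw [h, (PiLp.volume_preserving_ofLp ι).measure_preimage
    (MeasurableSet.univ_pi fun i => measurableSet_Ioo).nullMeasurableSet, volume_pi_pi]
  have : ∀ i, c i + 1 / 2 - (c i - 1 / 2) = 1 := fun i => by ring
  simp only [Real.volume_Ioo, this]
  simp

theorem volume_closedCube_lt_top {ι : Type*} [Fintype ι] (c : ι → ℝ) :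
    volume (closedCube c) < ⊤ := by
  have h : closedCube c = (WithLp.ofLp : EuclideanSpace ℝ ι → ι → ℝ) ⁻¹'
      (Set.pi univ fun i => Icc (c i - 1 / 2) (c i + 1 / 2)) := by
    ext x
    simp only [closedCube, mem_ofPred_eq, mem_preimage, mem_univ_pi, mem_Icc, abs_le]
    refine forall_congr' fun i => ?_
    constructor <;> rintro ⟨h1, h2⟩ <;> constructor <;> linarith
  rw [h, (PiLp.volume_preserving_ofLp ι).measure_preimage
    (MeasurableSet.univ_pi fun i => measurableSet_Icc).nullMeasurableSet, volume_pi_pi]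
  simp only [Real.volume_Icc]
  exact ENNReal.prod_lt_top fun i _ => ENNReal.ofReal_lt_top

/-- The isometric embedding of `ℝ^e` in `ℝ^(e+1)` as the hyperplane `x i = t`. -/
def hyperplaneEmbedding (i : Fin (e + 1)) (t : ℝ) (y : EuclideanSpace ℝ (Fin e)) :
    EuclideanSpace ℝ (Fin (e + 1)) := WithLp.toLp 2 (i.insertNth (α := fun _ => ℝ) t y.ofLp)

theorem isometry_hyperplaneEmbedding (i : Fin (e + 1)) (t : ℝ) :
    Isometry (hyperplaneEmbedding i t) := by
  refine Isometry.of_dist_eq fun x y => ?_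
  rw [EuclideanSpace.dist_eq, EuclideanSpace.dist_eq, Fin.sum_univ_succAbove _ i]
  simp [hyperplaneEmbedding]

theorem mem_image_hyperplaneEmbedding {i : Fin (e + 1)} {t : ℝ} {s : Set (EuclideanSpace ℝ (Fin e))}
    {x : EuclideanSpace ℝ (Fin (e + 1))} :
    x ∈ hyperplaneEmbedding i t '' s ↔
      x i = t ∧ WithLp.toLp 2 (fun j => x (i.succAbove j)) ∈ s := by
  constructor
  · rintro ⟨y, hy, rfl⟩
    simpa [hyperplaneEmbedding] using hy
  · rintro ⟨h1, h2⟩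
    refine ⟨_, h2, ?_⟩
    ext j
    refine Fin.succAboveCases i ?_ (fun j => ?_) j <;> simp [hyperplaneEmbedding, h1]

/-- The relatively open face of the unit cube centred at `n` in the direction `i`. -/
def openFace (i : Fin (e + 1)) (n : Fin (e + 1) → ℤ) : Set (EuclideanSpace ℝ (Fin (e + 1))) :=
  hyperplaneEmbedding i (n i + 1 / 2) '' openCube fun j => (n (i.succAbove j) : ℝ)

theorem mem_openFace {i : Fin (e + 1)} {n : Fin (e + 1) → ℤ}
    {x : EuclideanSpace ℝ (Fin (e + 1))} :
    x ∈ openFace i n ↔ x i = n i + 1 / 2 ∧ ∀ j, j ≠ i → |x j - n j| < 1 / 2 := by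
  rw [openFace, mem_image_hyperplaneEmbedding]
  refine and_congr_right fun _ => ?_
  simp only [openCube, mem_ofPred_eq]
  constructor
  · intro h j hj
    obtain ⟨k, rfl⟩ := Fin.exists_succAbove_eq hj
    exact h k
  · intro h j
    exact h _ (Fin.succAbove_ne i j)

theorem euclideanHausdorffMeasure_openFace (i : Fin (e + 1)) (n : Fin (e + 1) → ℤ) :
    (Measure.euclideanHausdorffMeasure e : Measure (EuclideanSpace ℝ (Fin (e + 1))))
      (openFace i n) = 1 := by
  rw [openFace, (isometry_hyperplaneEmbedding i _).euclideanHausdorffMeasure_image,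
    EuclideanSpace.euclideanHausdorffMeasure_eq_volume, volume_openCube]

theorem measurableSet_openFace (i : Fin (e + 1)) (n : Fin (e + 1) → ℤ) :
    MeasurableSet (openFace i n) := by
  have h : openFace i n = {x | x i = (n i : ℝ) + 1 / 2} ∩
      ⋂ j, {x | j ≠ i → |x j - (n j : ℝ)| < 1 / 2} := by
    ext x
    simp only [mem_openFace, mem_inter_iff, mem_ofPred_eq, mem_iInter]
  rw [h]
  refine MeasurableSet.inter (isClosed_eq (by fun_prop) continuous_const).measurableSet
    (MeasurableSet.iInter fun j => ?_)
  by_cases hj : j = i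
  · simp [hj]
  · simp only [ne_eq, hj, not_false_eq_true, forall_const]
    exact (isOpen_lt (by fun_prop) continuous_const).measurableSet

theorem int_abs_lt_half_unique {x : ℝ} {a b : ℤ} (h1 : |x - a| < 1 / 2) (h2 : |x - b| ≤ 1 / 2) :
    a = b := by
  rw [abs_lt] at h1
  rw [abs_le] at h2
  have h3 : (a : ℝ) < b + 1 := by linarith
  have h4 : (b : ℝ) < a + 1 := by linarith
  have h3' : a < b + 1 := by exact_mod_cast h3
  have h4' : b < a + 1 := by exact_mod_cast h4
  omega

/-- For different directions, coordinate `i` would be a half-integer on one face and at distance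
less than `1/2` from an integer on the other. -/
theorem disjoint_openFace {i i' : Fin (e + 1)} {n n' : Fin (e + 1) → ℤ} (h : (i, n) ≠ (i', n')) :
    Disjoint (openFace i n) (openFace i' n') := by
  rw [Set.disjoint_left]
  intro x hx hx'
  rw [mem_openFace] at hx hx'
  apply h
  by_cases hi : i = i'
  · subst hi
    refine Prod.ext rfl (funext fun j => ?_)
    by_cases hj : j = i
    · subst hj
      have : (n j : ℝ) = n' j := by linarith [hx.1, hx'.1]
      exact_mod_cast this
    · exact int_abs_lt_half_unique (hx.2 j hj) (hx'.2 j hj).le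
  · exfalso
    have h2 := hx'.2 i hi
    have h3 : |x i - ((n i + 1 : ℤ) : ℝ)| ≤ 1 / 2 := by
      rw [hx.1]; push_cast
      rw [abs_le]; constructor <;> linarith
    have h4 : |x i - (n i : ℝ)| ≤ 1 / 2 := by
      rw [hx.1, abs_le]; constructor <;> linarith
    have := int_abs_lt_half_unique h2 h3
    have := int_abs_lt_half_unique h2 h4
    omega

theorem cubeComplex_eq_biUnion_closedCube {d : ℕ} (X : Set (Fin d → ℤ)) :
    cubeComplex X = ⋃ n ∈ X, closedCube fun i => (n i : ℝ) := rfl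

/-- The face lies in both adjacent closed cubes. The one with centre in `X` puts it in the complex.
The open cube of the other misses the complex and is reached along the segment from its centre. -/
theorem openFace_subset_frontier {X : Set (Fin (e + 1) → ℤ)} {i : Fin (e + 1)}
    {n : Fin (e + 1) → ℤ} (h : n ∈ X ↔ n + Pi.single i 1 ∉ X) :
    openFace i n ⊆ frontier (cubeComplex X) := by
  intro x hx
  rw [mem_openFace] at hx
  have hm : ∀ n' : Fin (e + 1) → ℤ, n' = n ∨ n' = n + Pi.single i 1 →
      x ∈ closedCube (fun i => (n' i : ℝ)) := by
    intro n' hn' j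
    by_cases hj : j = i
    · subst hj
      rcases hn' with rfl | rfl
      · rw [hx.1, abs_le]; constructor <;> linarith
      · rw [hx.1, abs_le]; simp only [Pi.add_apply, Pi.single_eq_same]; push_cast
        constructor <;> linarith
    · have hj' : n' j = n j := by rcases hn' with rfl | rfl <;> simp [hj]
      simp only [hj']
      exact (hx.2 j hj).le
  have hout : ∀ n', n' ∉ X → x ∈ closedCube (fun i => (n' i : ℝ)) →
      x ∈ closure (cubeComplex X)ᶜ := by
    intro n' hn' hxn'
    have hsub : openCube (fun i => (n' i : ℝ)) ⊆ (cubeComplex X)ᶜ := by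
      intro z hz hz'
      rw [cubeComplex_eq_biUnion_closedCube] at hz'
      simp only [mem_iUnion] at hz'
      obtain ⟨n'', h1, h2⟩ := hz'
      have : n' = n'' := funext fun j => int_abs_lt_half_unique (hz j) (h2 j)
      exact hn' (this ▸ h1)
    refine closure_mono hsub ?_
    set c : EuclideanSpace ℝ (Fin (e + 1)) := WithLp.toLp 2 fun i => (n' i : ℝ) with hc
    have ht : Tendsto (fun t : ℝ => c + t • (x - c)) (𝓝[<] 1) (𝓝 x) := by
      have : Tendsto (fun t : ℝ => c + t • (x - c)) (𝓝 1) (𝓝 (c + (1 : ℝ) • (x - c))) :=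
        (by fun_prop : Continuous fun t : ℝ => c + t • (x - c)).tendsto 1
      rw [one_smul, add_sub_cancel] at this
      exact this.mono_left nhdsWithin_le_nhds
    refine mem_closure_of_tendsto ht ?_
    have h01 : Ioo (0 : ℝ) 1 ∈ 𝓝[<] (1 : ℝ) := Ioo_mem_nhdsLT (by norm_num)
    filter_upwards [h01] with t ht j
    have : (c + t • (x - c)) j - (n' j : ℝ) = t * (x j - n' j) := by simp [hc]
    rw [this, abs_mul, abs_of_pos ht.1]
    have := hxn' j
    have h3 := ht.1
    have h4 := ht.2
    nlinarith [abs_nonneg (x j - n' j)]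
  have hin : ∀ n', n' ∈ X → x ∈ closedCube (fun i => (n' i : ℝ)) → x ∈ closure (cubeComplex X) := by
    intro n' h1 h2
    refine subset_closure ?_
    rw [cubeComplex_eq_biUnion_closedCube]
    exact mem_biUnion h1 h2
  rw [frontier_eq_closure_inter_closure]
  by_cases hn : n ∈ X
  · exact ⟨hin n hn (hm n (Or.inl rfl)), hout _ (h.1 hn) (hm _ (Or.inr rfl))⟩
  · have : n + Pi.single i 1 ∈ X := by tauto
    exact ⟨hin _ this (hm _ (Or.inr rfl)), hout _ hn (hm _ (Or.inl rfl))⟩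

theorem frontier_closedCube_subset (c : Fin (e + 1) → ℝ) :
    frontier (closedCube c) ⊆ ⋃ p : Fin (e + 1) × Bool,
      hyperplaneEmbedding p.1 (c p.1 + if p.2 then 1 / 2 else -(1 / 2)) ''
        closedCube fun j => c (p.1.succAbove j) := by
  intro x hx
  have h1 : x ∈ closedCube c := (isClosed_closedCube c).frontier_subset hx
  have h2 : x ∉ openCube c := fun h =>
    hx.2 (interior_maximal (openCube_subset_closedCube c) (isOpen_openCube c) h)
  simp only [openCube, mem_ofPred_eq, not_forall, not_lt] at h2
  obtain ⟨i, hi⟩ := h2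
  have hi : |x i - c i| = 1 / 2 := le_antisymm (h1 i) hi
  rw [mem_iUnion]
  rcases (abs_eq (by norm_num)).1 hi with h | h
  · refine ⟨(i, true), ?_⟩
    rw [mem_image_hyperplaneEmbedding]
    exact ⟨by simp only [if_true]; linarith, fun j => h1 _⟩
  · refine ⟨(i, false), ?_⟩
    rw [mem_image_hyperplaneEmbedding]
    exact ⟨by simp only [Bool.false_eq_true, if_false]; linarith, fun j => h1 _⟩

/-- Needed because `boundaryArea` is defined with `toReal`, which sends `⊤` to `0`. -/
theorem euclideanHausdorffMeasure_frontier_cubeComplex_lt_top {X : Set (Fin (e + 1) → ℤ)}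
    (hX : X.Finite) :
    (Measure.euclideanHausdorffMeasure e : Measure (EuclideanSpace ℝ (Fin (e + 1))))
      (frontier (cubeComplex X)) < ⊤ := by
  have hsub : frontier (cubeComplex X) ⊆ ⋃ n ∈ X, frontier (closedCube fun i => (n i : ℝ)) := by
    intro x hx
    have hcl : IsClosed (cubeComplex X) := by
      rw [cubeComplex_eq_biUnion_closedCube]
      exact hX.isClosed_biUnion fun n _ => isClosed_closedCube _
    have h1 := hcl.frontier_subset hx
    rw [cubeComplex_eq_biUnion_closedCube] at h1
    simp only [mem_iUnion] at h1 ⊢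
    obtain ⟨n, hn, hxn⟩ := h1
    refine ⟨n, hn, subset_closure hxn, fun hi => hx.2 ?_⟩
    refine interior_mono ?_ hi
    rw [cubeComplex_eq_biUnion_closedCube]
    exact subset_biUnion_of_mem (u := fun n : Fin (e + 1) → ℤ => closedCube fun i => (n i : ℝ)) hn
  refine (measure_mono hsub).trans_lt ?_
  refine measure_biUnion_lt_top hX fun n _ => ?_
  refine (measure_mono (frontier_closedCube_subset _)).trans_lt ?_
  refine (measure_iUnion_le _).trans_lt ?_
  rw [tsum_fintype]
  refine ENNReal.sum_lt_top.2 fun p _ => ?_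
  rw [(isometry_hyperplaneEmbedding _ _).euclideanHausdorffMeasure_image,
    EuclideanSpace.euclideanHausdorffMeasure_eq_volume]
  exact volume_closedCube_lt_top _

/-- Each cut edge crosses its own open face of measure `1`, and these faces are disjoint subsets of
the boundary. -/
theorem card_cutEdges_le_boundaryArea {d : ℕ} (hd : 1 ≤ d) (Q X : Finset (Fin d → ℤ)) :
    ((cutEdges Q X).card : ℝ) ≤ boundaryArea (cubeComplex (X : Set (Fin d → ℤ))) := by
  obtain ⟨e, rfl⟩ := Nat.exists_eq_add_of_le' hd
  have hfin := euclideanHausdorffMeasure_frontier_cubeComplex_lt_top X.finite_toSet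
  rw [boundaryArea, Nat.add_sub_cancel, ← ENNReal.toReal_natCast]
  refine ENNReal.toReal_mono hfin.ne ?_
  calc ((cutEdges Q X).card : ENNReal)
      = ∑ p ∈ cutEdges Q X, (Measure.euclideanHausdorffMeasure e :
          Measure (EuclideanSpace ℝ (Fin (e + 1)))) (openFace p.1 p.2) := by
        simp [euclideanHausdorffMeasure_openFace]
    _ = (Measure.euclideanHausdorffMeasure e : Measure (EuclideanSpace ℝ (Fin (e + 1))))
          (⋃ p ∈ cutEdges Q X, openFace p.1 p.2) := by
        rw [measure_biUnion_finset]
        · intro p _ q _ hpq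
          exact disjoint_openFace hpq
        · exact fun p _ => measurableSet_openFace _ _
    _ ≤ _ := by
        refine measure_mono (iUnion₂_subset fun p hp => ?_)
        refine openFace_subset_frontier ?_
        simpa using (Finset.mem_filter.1 hp).2.2

end Boundary

/-! ### Fourier majorants of intervals on the circle -/

section Fourier

/-- The character `x ↦ exp (2 π i x)` of `ℝ/ℤ`. -/
def unitExp (x : ℝ) : ℂ := Complex.exp (2 * Real.pi * Complex.I * x)

theorem unitExp_add (x y : ℝ) : unitExp (x + y) = unitExp x * unitExp y := by
  simp only [unitExp, ← Complex.exp_add]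
  push_cast
  ring_nf

theorem unitExp_zero : unitExp 0 = 1 := by simp [unitExp]

theorem unitExp_intCast (n : ℤ) : unitExp n = 1 := by
  rw [unitExp, ← Complex.exp_int_mul_two_pi_mul_I n]
  push_cast
  ring_nf

theorem unitExp_sum {ι : Type*} (s : Finset ι) (f : ι → ℝ) :
    unitExp (∑ i ∈ s, f i) = ∏ i ∈ s, unitExp (f i) := by
  simp only [unitExp, ← Complex.exp_sum]
  push_cast
  rw [Finset.mul_sum]

theorem norm_unitExp (x : ℝ) : ‖unitExp x‖ = 1 := by
  have : unitExp x = Complex.exp ((2 * Real.pi * x : ℝ) * Complex.I) := by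
    rw [unitExp]; push_cast; ring_nf
  rw [this, Complex.norm_exp_ofReal_mul_I]

theorem unitExp_int_mul_fract (k : ℤ) (x : ℝ) : unitExp (k * Int.fract x) = unitExp (k * x) := by
  have h : (k : ℝ) * x = k * Int.fract x + ((k * ⌊x⌋ : ℤ) : ℝ) := by
    push_cast
    rw [← mul_add, Int.fract_add_floor]
  rw [h, unitExp_add, unitExp_intCast, mul_one]

theorem norm_unitExp_sub_one_le (x : ℝ) : ‖unitExp x - 1‖ ≤ 2 * Real.pi * |x| := by
  have : unitExp x = Complex.exp (Complex.I * (2 * Real.pi * x : ℝ)) := by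
    rw [unitExp]; push_cast; ring_nf
  rw [this]
  refine (Real.norm_exp_I_mul_ofReal_sub_one_le).trans ?_
  rw [Real.norm_eq_abs, abs_mul, abs_of_pos Real.two_pi_pos]

theorem norm_unitExp_neg_sub_one (x : ℝ) : ‖unitExp (-x) - 1‖ = ‖unitExp x - 1‖ := by
  have h : unitExp (-x) - 1 = -(unitExp (-x) * (unitExp x - 1)) := by
    rw [mul_sub, ← unitExp_add]
    simp [unitExp_zero]
  rw [h, norm_neg, norm_mul, norm_unitExp, one_mul]

theorem hasSum_of_eq {f g : ℤ → ℂ} {a b : ℂ} (h : HasSum f a) (hf : ∀ k, g k = f k) (ha : b = a) :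
    HasSum g b := by
  rw [ha, funext hf]
  exact h

/-- The periodic extension of the second Bernoulli polynomial. -/
def periodicBernoulliTwo (x : ℝ) : ℝ := Int.fract x ^ 2 - Int.fract x + 6⁻¹

theorem hasSum_periodicBernoulliTwo (x : ℝ) :
    HasSum (fun k : ℤ => 1 / (k : ℂ) ^ 2 * unitExp (k * x))
      ((2 * Real.pi ^ 2 * periodicBernoulliTwo x : ℝ) : ℂ) := by
  have hx : Int.fract x ∈ Icc (0 : ℝ) 1 := ⟨Int.fract_nonneg x, (Int.fract_lt_one x).le⟩
  have h := hasSum_one_div_pow_mul_fourier_mul_bernoulliFun le_rfl hx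
  refine hasSum_of_eq h (fun k => ?_) ?_
  · rw [fourier_coe_apply, ← unitExp_int_mul_fract, unitExp]
    push_cast
    ring_nf
  · rw [bernoulliFun_two, periodicBernoulliTwo, mul_pow, Complex.I_sq]
    push_cast
    simp only [Nat.factorial]
    push_cast
    ring

/-- Away from its jump the sawtooth is half the derivative of the second Bernoulli polynomial. A
backward difference quotient bounds it from above, and a forward one, in the next lemma, from below.
The gain is an absolutely convergent Fourier series. -/
theorem fract_sub_half_le {δ : ℝ} (h0 : 0 < δ) (h1 : δ ≤ 1) (x : ℝ) :
    Int.fract x - 1 / 2 ≤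
      (periodicBernoulliTwo x - periodicBernoulliTwo (x - δ)) / (2 * δ) + δ / 2 := by
  simp only [periodicBernoulliTwo]
  set u := Int.fract x with hu
  have hu0 : 0 ≤ u := Int.fract_nonneg x
  have hu1 : u < 1 := Int.fract_lt_one x
  have hxu : x = ⌊x⌋ + u := (Int.floor_add_fract x).symm
  rw [← sub_le_iff_le_add, le_div_iff₀ (by linarith)]
  by_cases h : δ ≤ u
  · have : Int.fract (x - δ) = u - δ := by
      rw [Int.fract_eq_iff]
      exact ⟨by linarith, by linarith, ⌊x⌋, by linarith⟩
    rw [this]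
    nlinarith
  · have : Int.fract (x - δ) = u - δ + 1 := by
      rw [Int.fract_eq_iff]
      exact ⟨by linarith, by linarith, ⌊x⌋ - 1, by push_cast; linarith⟩
    rw [this]
    nlinarith

theorem le_fract_sub_half {δ : ℝ} (h0 : 0 < δ) (h1 : δ ≤ 1) (x : ℝ) :
    (periodicBernoulliTwo (x + δ) - periodicBernoulliTwo x) / (2 * δ) - δ / 2 ≤
      Int.fract x - 1 / 2 := by
  simp only [periodicBernoulliTwo]
  set u := Int.fract x with hu
  have hu0 : 0 ≤ u := Int.fract_nonneg x
  have hu1 : u < 1 := Int.fract_lt_one x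
  have hxu : x = ⌊x⌋ + u := (Int.floor_add_fract x).symm
  rw [sub_le_iff_le_add, div_le_iff₀ (by linarith)]
  by_cases h : u + δ < 1
  · have : Int.fract (x + δ) = u + δ := by
      rw [Int.fract_eq_iff]
      exact ⟨by linarith, by linarith, ⌊x⌋, by linarith⟩
    rw [this]
    nlinarith
  · have : Int.fract (x + δ) = u + δ - 1 := by
      rw [Int.fract_eq_iff]
      exact ⟨by linarith, by linarith, ⌊x⌋ + 1, by push_cast; linarith⟩
    rw [this]
    nlinarith

theorem indicator_Ico_fract_le {a b : ℝ} (ha : 0 ≤ a) (hab : a ≤ b) (hb : b ≤ 1) (x : ℝ) :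
    (if Int.fract x ∈ Ico a b then (1 : ℝ) else 0) ≤
      b - a + Int.fract (x - b) - Int.fract (x - a) := by
  have hu0 : 0 ≤ Int.fract x := Int.fract_nonneg x
  have hu1 : Int.fract x < 1 := Int.fract_lt_one x
  have hxu : x = ⌊x⌋ + Int.fract x := (Int.floor_add_fract x).symm
  split_ifs with h
  · have h1 : Int.fract (x - b) = Int.fract x - b + 1 := by
      rw [Int.fract_eq_iff]
      exact ⟨by linarith [h.1], by linarith [h.2], ⌊x⌋ - 1, by push_cast; linarith⟩
    have h2 : Int.fract (x - a) = Int.fract x - a := by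
      rw [Int.fract_eq_iff]
      exact ⟨by linarith [h.1], by linarith [h.2], ⌊x⌋, by linarith⟩
    rw [h1, h2]
    linarith
  · have h1 : Int.fract (x - a) ≤ Int.fract (x - b) + Int.fract (b - a) := by
      have := Int.fract_add_le (x - b) (b - a)
      rwa [sub_add_sub_cancel] at this
    have h2 : Int.fract (b - a) ≤ b - a := by
      have := Int.floor_nonneg.2 (sub_nonneg.2 hab)
      have h3 : (0 : ℝ) ≤ ⌊b - a⌋ := by exact_mod_cast this
      rw [Int.fract]; linarith
    linarith

/-- The indicator is at most `b - a` plus a difference of two sawtooth functions, which are replaced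
by their one-sided Bernoulli bounds. The coefficients that result are at most of order `min (1/|k|,
1/(δ k²))`, and the stated bound interpolates between the two terms. -/
theorem exists_fourier_majorant {a b δ θ : ℝ} (ha : 0 ≤ a) (hab : a ≤ b) (hb : b ≤ 1) (hδ : 0 < δ)
    (hδ1 : δ ≤ 1) (hθ : 0 < θ) (hθ1 : θ < 1) :
    ∃ (c : ℤ → ℂ) (g : ℝ → ℝ), c 0 = (b - a + δ : ℝ) ∧
      (∀ k : ℤ, k ≠ 0 → ‖c k‖ ≤ δ ^ (-θ) * |(k : ℝ)| ^ (-(1 + θ))) ∧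
      (∀ x, HasSum (fun k : ℤ => c k * unitExp (k * x)) (g x)) ∧
      ∀ x, (if Int.fract x ∈ Ico a b then (1 : ℝ) else 0) ≤ g x := by
  have hπ := Real.pi_pos
  -- The factor `1/(2δ)` of the difference quotients, divided by the `2π²` of the Fourier series of
  -- the Bernoulli function.
  set γ : ℝ := 1 / (4 * Real.pi ^ 2 * δ) with hγ
  set w : ℤ → ℂ := fun k => unitExp (k * (-b)) - unitExp (k * (-b - δ)) -
    unitExp (k * (-a + δ)) + unitExp (k * (-a)) with hw
  set c₁ : ℤ → ℂ := fun k => γ * (1 / (k : ℂ) ^ 2 * w k) with hc₁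
  set G : ℝ → ℝ := fun x => γ * (2 * Real.pi ^ 2 * periodicBernoulliTwo (x - b) -
    2 * Real.pi ^ 2 * periodicBernoulliTwo (x - b - δ) -
    2 * Real.pi ^ 2 * periodicBernoulliTwo (x - a + δ) +
    2 * Real.pi ^ 2 * periodicBernoulliTwo (x - a)) with hG
  have hsum : ∀ x, HasSum (fun k : ℤ => c₁ k * unitExp (k * x)) (G x) := by
    intro x
    have h := ((((hasSum_periodicBernoulliTwo (x - b)).sub
      (hasSum_periodicBernoulliTwo (x - b - δ))).sub
      (hasSum_periodicBernoulliTwo (x - a + δ))).add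
      (hasSum_periodicBernoulliTwo (x - a))).mul_left (γ : ℂ)
    refine hasSum_of_eq h (fun k => ?_) ?_
    · have e1 : (k : ℝ) * (x - b) = k * (-b) + k * x := by ring
      have e2 : (k : ℝ) * (x - b - δ) = k * (-b - δ) + k * x := by ring
      have e3 : (k : ℝ) * (x - a + δ) = k * (-a + δ) + k * x := by ring
      have e4 : (k : ℝ) * (x - a) = k * (-a) + k * x := by ring
      rw [e1, e2, e3, e4]
      simp only [unitExp_add, hc₁, hw]
      ring
    · simp only [hG]
      push_cast
      ring
  have hG' : ∀ x, (if Int.fract x ∈ Ico a b then (1 : ℝ) else 0) ≤ (b - a + δ) + G x := by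
    intro x
    refine (indicator_Ico_fract_le ha hab hb x).trans ?_
    have h1 := fract_sub_half_le hδ hδ1 (x - b)
    have h2 := le_fract_sub_half hδ hδ1 (x - a)
    have h3 : G x = (periodicBernoulliTwo (x - b) - periodicBernoulliTwo (x - b - δ)) / (2 * δ) -
        (periodicBernoulliTwo (x - a + δ) - periodicBernoulliTwo (x - a)) / (2 * δ) := by
      simp only [hG, hγ]
      field_simp
      ring
    rw [h3]
    linarith
  refine ⟨fun k => (if k = 0 then ((b - a + δ : ℝ) : ℂ) else 0) + c₁ k,
    fun x => (b - a + δ) + G x, by simp [hc₁], ?_, ?_, hG'⟩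
  · intro k hk
    have hk' : (0 : ℝ) < |(k : ℝ)| := abs_pos.2 (by exact_mod_cast hk)
    simp only [hk, if_false, zero_add, hc₁]
    have hwb : ‖w k‖ ≤ 2 * ‖unitExp (k * δ) - 1‖ := by
      have : w k = -(unitExp (k * (-b)) * (unitExp (-(k * δ)) - 1)) -
          unitExp (k * (-a)) * (unitExp (k * δ) - 1) := by
        have e2 : (k : ℝ) * (-b - δ) = k * (-b) + -(k * δ) := by ring
        have e3 : (k : ℝ) * (-a + δ) = k * (-a) + k * δ := by ring
        simp only [hw, e2, e3, unitExp_add]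
        ring
      rw [this]
      refine (norm_sub_le _ _).trans ?_
      rw [norm_neg, norm_mul, norm_mul, norm_unitExp, norm_unitExp, norm_unitExp_neg_sub_one]
      linarith
    set y : ℝ := |(k : ℝ)| * δ with hy
    have hy0 : 0 < y := by positivity
    -- For `y ≤ 1` this comes from the Lipschitz bound on `unitExp`, for `y ≥ 1` from the trivial
    -- bound `4`.
    have hwy : ‖w k‖ ≤ 4 * Real.pi * y ^ (1 - θ) := by
      rcases le_total y 1 with h | h
      · have h1 : y ≤ y ^ (1 - θ) := by
          conv_lhs => rw [← Real.rpow_one y]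
          exact Real.rpow_le_rpow_of_exponent_ge hy0 h (by linarith)
        have h2 := norm_unitExp_sub_one_le (k * δ)
        rw [abs_mul, abs_of_pos hδ, ← hy] at h2
        calc _ ≤ _ := hwb
          _ ≤ 2 * (2 * Real.pi * y) := by linarith
          _ = 4 * Real.pi * y := by ring
          _ ≤ _ := mul_le_mul_of_nonneg_left h1 (by positivity)
      · have h1 : 1 ≤ y ^ (1 - θ) := Real.one_le_rpow h (by linarith)
        have h2 : ‖unitExp (k * δ) - 1‖ ≤ 2 := by
          refine (norm_sub_le _ _).trans ?_
          rw [norm_unitExp]; norm_num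
        have h3 : 4 ≤ 4 * Real.pi := by linarith [Real.pi_gt_three]
        nlinarith
    rw [norm_mul, norm_mul, Complex.norm_real, norm_div (1 : ℂ), norm_one, norm_pow]
    have hkn : ‖(k : ℂ)‖ = |(k : ℝ)| := by
      rw [← Complex.ofReal_intCast, Complex.norm_real, Real.norm_eq_abs]
    have hγ0 : 0 < γ := by positivity
    rw [hkn, Real.norm_eq_abs, abs_of_pos hγ0]
    have e1 : y ^ (1 - θ) = |(k : ℝ)| ^ 2 * |(k : ℝ)| ^ (-(1 + θ)) * (δ * δ ^ (-θ)) := by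
      rw [hy, Real.mul_rpow hk'.le hδ.le]
      have a1 : |(k : ℝ)| ^ (1 - θ) = |(k : ℝ)| ^ 2 * |(k : ℝ)| ^ (-(1 + θ)) := by
        rw [← Real.rpow_natCast, ← Real.rpow_add hk']
        congr 1; push_cast; ring
      have a2 : δ ^ (1 - θ) = δ * δ ^ (-θ) := by
        conv_rhs => rw [← Real.rpow_one δ, ← Real.rpow_mul hδ.le, ← Real.rpow_add hδ]
        congr 1; ring
      rw [a1, a2]
    have hpos : 0 ≤ δ ^ (-θ) * |(k : ℝ)| ^ (-(1 + θ)) := by positivity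
    calc γ * (1 / |(k : ℝ)| ^ 2 * ‖w k‖)
        ≤ γ * (1 / |(k : ℝ)| ^ 2 * (4 * Real.pi * y ^ (1 - θ))) :=
          mul_le_mul_of_nonneg_left (mul_le_mul_of_nonneg_left hwy (by positivity)) hγ0.le
      _ = (1 / Real.pi) * (δ ^ (-θ) * |(k : ℝ)| ^ (-(1 + θ))) := by
          rw [e1, hγ]
          field_simp
      _ ≤ 1 * (δ ^ (-θ) * |(k : ℝ)| ^ (-(1 + θ))) := by
          refine mul_le_mul_of_nonneg_right ?_ hpos
          rw [div_le_one hπ]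
          linarith [Real.pi_gt_three]
      _ = _ := one_mul _
  · intro x
    have h1 : HasSum (fun k : ℤ => (if k = 0 then ((b - a + δ : ℝ) : ℂ) else 0) * unitExp (k * x))
        ((b - a + δ : ℝ) : ℂ) := by
      refine hasSum_of_eq (hasSum_ite_eq (0 : ℤ) ((b - a + δ : ℝ) : ℂ)) (fun k => ?_) rfl
      split_ifs with h
      · simp [h, unitExp_zero]
      · simp
    have := h1.add (hsum x)
    rw [← Complex.ofReal_add] at this
    simpa only [add_mul] using this

end Fourier

/-! ### Integrability of the resonances in the linear map -/

section Resonance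

theorem unitExp_eq_fourier (x : ℝ) : unitExp x = fourier 1 (x : UnitAddCircle) := by
  rw [fourier_coe_apply, unitExp]
  push_cast
  ring_nf

theorem four_mul_abs_le_norm_unitExp_sub_one {x : ℝ} (hx : |x| ≤ 1 / 2) :
    4 * |x| ≤ ‖unitExp x - 1‖ := by
  have h : unitExp x = Complex.exp (Complex.I * (2 * Real.pi * x : ℝ)) := by
    rw [unitExp]; push_cast; ring_nf
  rw [h, Complex.norm_exp_I_mul_ofReal_sub_one, norm_mul]
  have hπ := Real.pi_pos
  have h1 : |2 * Real.pi * x / 2| = Real.pi * |x| := by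
    rw [mul_assoc, mul_div_cancel_left₀ _ (two_ne_zero), abs_mul, abs_of_pos hπ]
  have h2 := Real.mul_abs_le_abs_sin (x := 2 * Real.pi * x / 2) (by rw [h1]; nlinarith)
  rw [h1] at h2
  have h3 : 2 / Real.pi * (Real.pi * |x|) = 2 * |x| := by field_simp
  rw [h3] at h2
  simp only [Real.norm_eq_abs, abs_two]
  linarith

/-- The size `|e(x) - 1| ^ (-p)` of the resonance at the frequency `x`. -/
def resonance (p : ℝ) (x : ℝ) : ENNReal := ‖unitExp x - 1‖ₑ ^ (-p)

theorem resonance_neg (p x : ℝ) : resonance p (-x) = resonance p x := by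
  rw [resonance, resonance, ← ofReal_norm, norm_unitExp_neg_sub_one, ofReal_norm]

theorem continuous_unitExp : Continuous unitExp := by
  unfold unitExp
  fun_prop

theorem measurable_resonance (p : ℝ) : Measurable (resonance p) := by
  have h : Continuous fun x => ‖unitExp x - 1‖ₑ := by
    have := continuous_unitExp
    fun_prop
  exact h.measurable.pow_const _

/-- Multiplication by `k ≠ 0` and translation both preserve Haar measure on the circle, so the
integral over a period does not depend on `k` or `c`. -/
theorem lintegral_resonance_affine (p : ℝ) (k : ℤ) (hk : k ≠ 0) (c : ℝ) (t : ℝ) :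
    ∫⁻ x in Ioc t (t + 1), resonance p (k * x + c) =
      ∫⁻ x in Ioc (-(1 / 2) : ℝ) (1 / 2), resonance p x := by
  set F : UnitAddCircle → ENNReal := fun b => ‖fourier 1 b - 1‖ₑ ^ (-p) with hF
  have hFm : Measurable F := by
    have h : Continuous fun b : UnitAddCircle => ‖fourier 1 b - 1‖ₑ := by fun_prop
    exact h.measurable.pow_const _
  have h1 : ∀ x : ℝ, resonance p (k * x + c) = F (k • (x : UnitAddCircle) + (c : UnitAddCircle)) := by
    intro x
    rw [resonance, unitExp_eq_fourier, hF]
    push_cast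
    rw [← zsmul_eq_mul]
    rfl
  have h2 : ∀ x : ℝ, resonance p x = F (x : UnitAddCircle) := by
    intro x
    rw [resonance, unitExp_eq_fourier, hF]
  have h3 := UnitAddCircle.lintegral_preimage (-(1 / 2)) F
  rw [show (-(1 / 2) + 1 : ℝ) = 1 / 2 by norm_num] at h3
  simp_rw [h1, h2]
  rw [UnitAddCircle.lintegral_preimage t
    (fun b => F (k • b + (c : UnitAddCircle))), h3]
  have hmp := MeasureTheory.Measure.measurePreserving_zsmul (volume : Measure UnitAddCircle) hk
  rw [hmp.lintegral_comp (f := fun b => F (b + (c : UnitAddCircle)))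
    (hFm.comp (measurable_add_const _)), lintegral_add_right_eq_self]

/-- Since `|e(x) - 1| ≥ 4|x|` for `|x| ≤ 1/2`, the singularity is at most `|x|^(-p)`, integrable
because `p < 1`. -/
theorem lintegral_resonance_lt_top {p : ℝ} (hp : 0 < p) (hp1 : p < 1) :
    ∫⁻ x in Ioc (-(1 / 2) : ℝ) (1 / 2), resonance p x < ⊤ := by
  have hint : ∫⁻ x in Ioc (0 : ℝ) (1 / 2), ENNReal.ofReal (x ^ (-p)) < ⊤ := by
    have h1 := (intervalIntegral.intervalIntegrable_rpow' (a := 0) (b := 1 / 2) (r := -p)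
      (by linarith)).1
    exact h1.lintegral_lt_top
  have hle : ∀ x ∈ Ioc (0 : ℝ) (1 / 2), resonance p x ≤ ENNReal.ofReal (x ^ (-p)) := by
    intro x hx
    have h0 := hx.1
    have h4 := four_mul_abs_le_norm_unitExp_sub_one (x := x) (by rw [abs_of_pos hx.1]; exact hx.2)
    rw [abs_of_pos h0] at h4
    rw [resonance, ← ofReal_norm, ENNReal.ofReal_rpow_of_pos (by linarith)]
    refine ENNReal.ofReal_le_ofReal ?_
    exact Real.rpow_le_rpow_of_nonpos h0 (by linarith) (by linarith)
  have hhalf : ∫⁻ x in Ioc (0 : ℝ) (1 / 2), resonance p x < ⊤ :=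
    (setLIntegral_mono' measurableSet_Ioc hle).trans_lt hint
  have hhalf' : ∫⁻ x in Ico (-(1 / 2) : ℝ) 0, resonance p x < ⊤ := by
    have hmp := (Measure.measurePreserving_neg (volume : Measure ℝ)).setLIntegral_comp_preimage
      (s := Ioc (0 : ℝ) (1 / 2)) measurableSet_Ioc (measurable_resonance p)
    rw [Set.neg_preimage, Set.neg_Ioc, neg_zero] at hmp
    simp_rw [resonance_neg] at hmp
    rw [hmp]
    exact hhalf
  calc _ ≤ ∫⁻ x in Ico (-(1 / 2) : ℝ) 0 ∪ ({0} ∪ Ioc (0 : ℝ) (1 / 2)), resonance p x := by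
        refine lintegral_mono_set fun x hx => ?_
        rcases lt_trichotomy x 0 with h | h | h
        · exact Or.inl ⟨hx.1.le, h⟩
        · exact Or.inr (Or.inl h)
        · exact Or.inr (Or.inr ⟨h, hx.2⟩)
    _ ≤ _ := lintegral_union_le _ _ _
    _ ≤ _ := add_le_add_right (lintegral_union_le _ _ _) _
    _ < ⊤ := by
        rw [setLIntegral_measure_zero {0} _ (by simp), zero_add]
        exact ENNReal.add_lt_top.2 ⟨hhalf', hhalf⟩

variable {d m : ℕ}

instance isProbabilityMeasure_restrict_Ioc (t : ℝ) :
    IsProbabilityMeasure (volume.restrict (Ioc t (t + 1))) := ⟨by simp⟩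

theorem lintegral_prod_resonance (p : ℝ) (k : ℤ) (hk : k ≠ 0) (c t : Fin d → ℝ) :
    ∫⁻ x, ∏ j, resonance p (k * x j + c j)
        ∂Measure.pi (fun j => volume.restrict (Ioc (t j) (t j + 1))) =
      (∫⁻ x in Ioc (-(1 / 2) : ℝ) (1 / 2), resonance p x) ^ d := by
  have hm : ∀ j, Measurable fun x : ℝ => resonance p (k * x + c j) := fun j =>
    (measurable_resonance p).comp (by fun_prop)
  rw [ProbabilityTheory.lintegral_prod_eq_prod_lintegral_of_indepFun Finset.univ
    (fun j (x : Fin d → ℝ) => resonance p (k * x j + c j))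
    (ProbabilityTheory.iIndepFun_pi fun j => (hm j).aemeasurable)
    (fun j => (hm j).comp (measurable_pi_apply j))]
  have : ∀ j, ∫⁻ x, resonance p (k * x j + c j)
      ∂Measure.pi (fun j => volume.restrict (Ioc (t j) (t j + 1))) =
      ∫⁻ x in Ioc (-(1 / 2) : ℝ) (1 / 2), resonance p x := by
    intro j
    rw [← lintegral_resonance_affine p k hk (c j) (t j)]
    exact (measurePreserving_eval (fun j => volume.restrict (Ioc (t j) (t j + 1))) j).lintegral_comp
      (hm j)
  simp [this]

/-- Integrating only over a row `i` with `k i ≠ 0` suffices: its entries are independent, each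
factor involves one of them, and the other rows act as translations. The bound is uniform in `k`. -/
theorem lintegral_matrix_resonance_le (p : ℝ) (k : Fin m → ℤ) (hk : k ≠ 0)
    (t : Fin m → Fin d → ℝ) :
    ∫⁻ α, ∏ j, resonance p (∑ i, k i * α i j) ∂Measure.pi (fun i =>
        Measure.pi fun j => volume.restrict (Ioc (t i j) (t i j + 1))) ≤
      (∫⁻ x in Ioc (-(1 / 2) : ℝ) (1 / 2), resonance p x) ^ d := by
  obtain ⟨i, hi⟩ : ∃ i, k i ≠ 0 := by
    by_contra h
    push Not at h
    exact hk (funext h)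
  set K := (∫⁻ x in Ioc (-(1 / 2) : ℝ) (1 / 2), resonance p x) ^ d with hK
  have hm : Measurable fun α : Fin m → Fin d → ℝ => ∏ j, resonance p (∑ i, k i * α i j) := by
    refine Finset.measurable_prod _ fun j _ => (measurable_resonance p).comp ?_
    fun_prop
  refine (lintegral_le_of_lmarginal_le (g := fun _ => K) {i} hm measurable_const ?_).trans ?_
  · intro α
    rw [lmarginal_singleton, lmarginal_singleton]
    have : ∀ (x : Fin d → ℝ) (j : Fin d), (∑ l, (k l : ℝ) * Function.update α i x l j) =
        k i * x j + ∑ l ∈ Finset.univ.erase i, (k l : ℝ) * α l j := by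
      intro x j
      rw [← Finset.add_sum_erase _ _ (Finset.mem_univ i), Function.update_self]
      congr 1
      refine Finset.sum_congr rfl fun l hl => ?_
      rw [Function.update_of_ne (Finset.ne_of_mem_erase hl)]
    simp_rw [this]
    rw [lintegral_prod_resonance p (k i) hi]
    simp [hK]
  · simp

/-- The weight of the frequency `k` in the Fourier expansions below. -/
def freqWeight (θ : ℝ) (k : ℤ) : ℝ := if k = 0 then 1 else |(k : ℝ)| ^ (-(1 + θ))

theorem freqWeight_pos (θ : ℝ) (k : ℤ) : 0 < freqWeight θ k := by
  unfold freqWeight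
  split_ifs with h
  · exact one_pos
  · exact Real.rpow_pos_of_pos (abs_pos.2 (by exact_mod_cast h)) _

theorem summable_freqWeight {θ : ℝ} (hθ : 0 < θ) : Summable (freqWeight θ) := by
  have h := (Real.summable_abs_int_rpow (b := 1 + θ) (by linarith))
  refine (h.add (summable_of_ne_finset_zero (f := fun k : ℤ => if k = 0 then (1 : ℝ) else 0)
    (s := {0}) ?_)).of_nonneg_of_le (fun k => (freqWeight_pos θ k).le) fun k => ?_
  · intro k hk
    simp only [Finset.mem_singleton] at hk
    simp [hk]
  · unfold freqWeight
    split_ifs with h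
    · have : 0 ≤ |(k : ℝ)| ^ (-(1 + θ)) := by positivity
      linarith
    · simp

theorem tsum_prod_freqWeight_lt_top {θ : ℝ} (hθ : 0 < θ) :
    ∑' k : Fin m → ℤ, ENNReal.ofReal (∏ i, freqWeight θ (k i)) < ⊤ := by
  refine lt_of_le_of_lt (b := ENNReal.ofReal ((∑' k, freqWeight θ k) ^ m)) ?_
    ENNReal.ofReal_lt_top
  rw [ENNReal.tsum_eq_iSup_sum]
  refine iSup_le fun K => ?_
  rw [← ENNReal.ofReal_sum_of_nonneg fun k _ => Finset.prod_nonneg fun i _ => (freqWeight_pos θ _).le]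
  refine ENNReal.ofReal_le_ofReal ?_
  calc ∑ k ∈ K, ∏ i, freqWeight θ (k i)
      ≤ ∑ k ∈ Fintype.piFinset fun i => K.image fun k => k i, ∏ i, freqWeight θ (k i) := by
        refine Finset.sum_le_sum_of_subset_of_nonneg (fun k hk => ?_)
          fun k _ _ => Finset.prod_nonneg fun i _ => (freqWeight_pos θ _).le
        rw [Fintype.mem_piFinset]
        exact fun i => Finset.mem_image_of_mem _ hk
    _ = ∏ i, ∑ l ∈ K.image fun k => k i, freqWeight θ l := (Finset.prod_univ_sum _ _).symm
    _ ≤ ∏ _i : Fin m, ∑' k, freqWeight θ k :=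
        Finset.prod_le_prod (fun i _ => Finset.sum_nonneg fun k _ => (freqWeight_pos θ k).le)
          fun i _ => (summable_freqWeight hθ).sum_le_tsum _ fun k _ => (freqWeight_pos θ k).le
    _ = _ := by simp

/-- On each unit cell of matrices the integral of the series is at most a summable weight times a
uniform constant, so the series is finite almost everywhere; countably many cells cover the space.
-/
theorem ae_tsum_resonance_lt_top {θ : ℝ} (hθ : 0 < θ) (hθ1 : θ < 1) :
    ∀ᵐ α : Fin m → Fin d → ℝ, ∑' k : {k : Fin m → ℤ // k ≠ 0},
      ENNReal.ofReal (∏ i, freqWeight θ (k.1 i)) *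
        ∏ j, resonance (1 - θ) (∑ i, k.1 i * α i j) < ⊤ := by
  set T : (Fin m → Fin d → ℝ) → ENNReal := fun α => ∑' k : {k : Fin m → ℤ // k ≠ 0},
      ENNReal.ofReal (∏ i, freqWeight θ (k.1 i)) *
        ∏ j, resonance (1 - θ) (∑ i, k.1 i * α i j) with hT
  have hm : ∀ k : {k : Fin m → ℤ // k ≠ 0}, Measurable fun α : Fin m → Fin d → ℝ =>
      ∏ j, resonance (1 - θ) (∑ i, k.1 i * α i j) := by
    intro k
    refine Finset.measurable_prod _ fun j _ => (measurable_resonance _).comp ?_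
    fun_prop
  have hTm : Measurable T := Measurable.tsum fun k => (hm k).const_mul _
  set cell : (Fin m → Fin d → ℤ) → Set (Fin m → Fin d → ℝ) := fun z =>
    Set.pi univ fun i => Set.pi univ fun j => Ioc (z i j : ℝ) (z i j + 1) with hcell
  have hcov : ⋃ z, cell z = univ := by
    refine eq_univ_of_forall fun α => mem_iUnion.2 ⟨fun i j => ⌈α i j⌉ - 1, fun i _ j _ => ?_⟩
    push_cast
    exact ⟨by linarith [Int.ceil_lt_add_one (α i j)], by linarith [Int.le_ceil (α i j)]⟩
  rw [← Measure.restrict_univ (μ := (volume : Measure (Fin m → Fin d → ℝ))), ← hcov,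
    ae_restrict_iUnion_iff]
  intro z
  have hvol : (volume : Measure (Fin m → Fin d → ℝ)).restrict (cell z) =
      Measure.pi fun i => Measure.pi fun j => volume.restrict (Ioc (z i j : ℝ) (z i j + 1)) := by
    rw [hcell, volume_pi, Measure.restrict_pi_pi]
    congr 1
    funext i
    rw [volume_pi, Measure.restrict_pi_pi]
  rw [hvol]
  refine ae_lt_top hTm (ne_of_lt ?_)
  rw [lintegral_tsum fun k => ((hm k).const_mul _).aemeasurable]
  simp_rw [lintegral_const_mul _ (hm _)]
  set K := (∫⁻ x in Ioc (-(1 / 2) : ℝ) (1 / 2), resonance (1 - θ) x) ^ d with hK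
  have hKtop : K < ⊤ :=
    ENNReal.pow_lt_top (lintegral_resonance_lt_top (by linarith) (by linarith))
  calc _ ≤ ∑' k : {k : Fin m → ℤ // k ≠ 0}, ENNReal.ofReal (∏ i, freqWeight θ (k.1 i)) * K :=
        ENNReal.tsum_le_tsum fun k =>
          mul_le_mul_right (lintegral_matrix_resonance_le _ k.1 k.2 fun i j => (z i j : ℝ)) _
    _ = (∑' k : {k : Fin m → ℤ // k ≠ 0}, ENNReal.ofReal (∏ i, freqWeight θ (k.1 i))) * K :=
        ENNReal.tsum_mul_right
    _ < ⊤ := by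
        refine ENNReal.mul_lt_top (lt_of_le_of_lt ?_ (tsum_prod_freqWeight_lt_top (m := m) hθ)) hKtop
        exact ENNReal.tsum_comp_le_tsum_of_injective Subtype.val_injective
          fun k : Fin m → ℤ => ENNReal.ofReal (∏ i, freqWeight θ (k i))

end Resonance

/-! ### Exponential sums over cubes -/

section ExponentialSums

variable {d m : ℕ}

theorem geom_sum_mul_unitExp (a : ℤ) (N : ℕ) (x : ℝ) :
    (∑ n ∈ Finset.Ico a (a + N), unitExp (n * x)) * (unitExp x - 1) =
      unitExp (((a + N : ℤ) : ℝ) * x) - unitExp (a * x) := by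
  induction N with
  | zero => simp
  | succ N ih =>
    have h : a + ((N + 1 : ℕ) : ℤ) = (a + N) + 1 := by push_cast; ring
    rw [h, ← Finset.insert_Ico_right_eq_Ico_add_one (by omega), Finset.sum_insert (by simp),
      add_mul, ih]
    have h2 : (((a + N + 1 : ℤ)) : ℝ) * x = ((a + N : ℤ) : ℝ) * x + x := by push_cast; ring
    rw [h2, unitExp_add]
    ring

/-- Interpolation between the trivial bound `N` and the bound `2 / |e(x) - 1|` of the geometric sum.
The exponent `1 - θ < 1` keeps the resonance integrable at the price of a factor `N^θ`. -/
theorem norm_geom_sum_le_resonance {θ : ℝ} (hθ : 0 < θ) (hθ1 : θ < 1) (a : ℤ) (N : ℕ) (x : ℝ) :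
    ENNReal.ofReal ‖∑ n ∈ Finset.Ico a (a + N), unitExp (n * x)‖ ≤
      ENNReal.ofReal (2 * (N : ℝ) ^ θ) * resonance (1 - θ) x := by
  set G := ‖∑ n ∈ Finset.Ico a (a + N), unitExp (n * x)‖ with hG
  set A := ‖unitExp x - 1‖ with hA
  have hGN : G ≤ N := by
    refine (norm_sum_le _ _).trans ?_
    simp [norm_unitExp]
  have hGA : G * A ≤ 2 := by
    rw [hG, hA, ← norm_mul, geom_sum_mul_unitExp]
    refine (norm_sub_le _ _).trans ?_
    rw [norm_unitExp, norm_unitExp]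
    norm_num
  have hG0 : 0 ≤ G := norm_nonneg _
  rcases hG0.eq_or_lt with h0 | h0
  · rw [← h0]; simp
  have hN0 : (0 : ℝ) < N := h0.trans_le hGN
  have hA0 : 0 ≤ A := norm_nonneg _
  rw [resonance, ← ofReal_norm, ← hA]
  rcases hA0.eq_or_lt with hA1 | hA1
  -- When `unitExp x = 1` the resonance is `⊤` and there is nothing to prove.
  · rw [← hA1, ENNReal.ofReal_zero, ENNReal.zero_rpow_of_neg (by linarith), ENNReal.mul_top]
    · exact le_top
    · rw [Ne, ENNReal.ofReal_eq_zero, not_le]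
      positivity
  · rw [ENNReal.ofReal_rpow_of_pos hA1, ← ENNReal.ofReal_mul (by positivity)]
    refine ENNReal.ofReal_le_ofReal ?_
    have h1 : G = G ^ θ * G ^ (1 - θ) := by
      rw [← Real.rpow_add h0, add_sub_cancel, Real.rpow_one]
    have h2 : G ^ θ ≤ (N : ℝ) ^ θ := Real.rpow_le_rpow hG0 hGN hθ.le
    have h3 : G ^ (1 - θ) ≤ 2 * A ^ (-(1 - θ)) := by
      calc G ^ (1 - θ) ≤ (2 * A⁻¹) ^ (1 - θ) := by
            refine Real.rpow_le_rpow hG0 ?_ (by linarith)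
            rw [← div_eq_mul_inv, le_div_iff₀ hA1]
            exact hGA
        _ = 2 ^ (1 - θ) * A ^ (-(1 - θ)) := by
            rw [Real.mul_rpow (by norm_num) (by positivity), Real.inv_rpow hA0, Real.rpow_neg hA0]
        _ ≤ 2 * A ^ (-(1 - θ)) := by
            refine mul_le_mul_of_nonneg_right ?_ (by positivity)
            conv_rhs => rw [← Real.rpow_one 2]
            exact Real.rpow_le_rpow_of_exponent_le (by norm_num) (by linarith)
    calc G = G ^ θ * G ^ (1 - θ) := h1
      _ ≤ (N : ℝ) ^ θ * (2 * A ^ (-(1 - θ))) := by gcongr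
      _ = _ := by ring

theorem sum_gridCube_unitExp (a : Fin d → ℤ) (N : ℕ) (y : Fin d → ℝ) :
    ∑ n ∈ gridCube a N, unitExp (∑ j, n j * y j) =
      ∏ j, ∑ n ∈ Finset.Ico (a j) (a j + N), unitExp (n * y j) := by
  rw [Finset.prod_univ_sum, gridCube]
  refine Finset.sum_congr rfl fun n _ => ?_
  rw [unitExp_sum]

theorem ae_exists_sum_norm_unitExp_le {θ : ℝ} (hθ : 0 < θ) (hθ1 : θ < 1) :
    ∀ᵐ α : Fin m → Fin d → ℝ, ∃ T : ℝ, 0 ≤ T ∧ ∀ (N : ℕ) (a : Fin d → ℤ)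
      (K : Finset (Fin m → ℤ)), 0 ∉ K →
      ∑ k ∈ K, (∏ i, freqWeight θ (k i)) *
        ‖∑ n ∈ gridCube a N, unitExp (∑ j, n j * -(∑ i, k i * α i j))‖ ≤ T * ((N : ℝ) ^ θ) ^ d := by
  filter_upwards [ae_tsum_resonance_lt_top (d := d) (m := m) hθ hθ1] with α hα
  set τ : ENNReal := ∑' k : {k : Fin m → ℤ // k ≠ 0}, ENNReal.ofReal (∏ i, freqWeight θ (k.1 i)) *
        ∏ j, resonance (1 - θ) (∑ i, k.1 i * α i j) with hτ
  refine ⟨2 ^ d * τ.toReal, by positivity, fun N a K hK => ?_⟩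
  have hw : ∀ k : Fin m → ℤ, 0 ≤ ∏ i, freqWeight θ (k i) := fun k =>
    Finset.prod_nonneg fun i _ => (freqWeight_pos θ _).le
  have key : ENNReal.ofReal (∑ k ∈ K, (∏ i, freqWeight θ (k i)) *
        ‖∑ n ∈ gridCube a N, unitExp (∑ j, n j * -(∑ i, k i * α i j))‖) ≤
      ENNReal.ofReal ((2 * (N : ℝ) ^ θ) ^ d) * τ := by
    rw [ENNReal.ofReal_sum_of_nonneg fun k _ => mul_nonneg (hw k) (norm_nonneg _)]
    calc _ ≤ ∑ k ∈ K, ENNReal.ofReal ((2 * (N : ℝ) ^ θ) ^ d) *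
          (ENNReal.ofReal (∏ i, freqWeight θ (k i)) *
            ∏ j, resonance (1 - θ) (∑ i, k i * α i j)) := by
          refine Finset.sum_le_sum fun k _ => ?_
          rw [ENNReal.ofReal_mul (hw k), mul_left_comm]
          refine mul_le_mul_right ?_ _
          rw [sum_gridCube_unitExp, norm_prod, ENNReal.ofReal_prod_of_nonneg fun _ _ => norm_nonneg _]
          refine (Finset.prod_le_prod' fun j _ =>
            norm_geom_sum_le_resonance hθ hθ1 (a j) N (-(∑ i, k i * α i j))).trans ?_
          rw [Finset.prod_mul_distrib, Finset.prod_const, Finset.card_univ, Fintype.card_fin,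
            ENNReal.ofReal_pow (by positivity)]
          simp only [resonance_neg, le_refl]
      _ = ENNReal.ofReal ((2 * (N : ℝ) ^ θ) ^ d) * ∑ k ∈ K,
          (ENNReal.ofReal (∏ i, freqWeight θ (k i)) *
            ∏ j, resonance (1 - θ) (∑ i, k i * α i j)) := by rw [Finset.mul_sum]
      _ ≤ _ := by
          refine mul_le_mul_right ?_ _
          rw [hτ, ← Finset.sum_subtype_of_mem (p := fun k : Fin m → ℤ => k ≠ 0)
            (fun k => ENNReal.ofReal (∏ i, freqWeight θ (k i)) *
              ∏ j, resonance (1 - θ) (∑ i, k i * α i j)) (fun k hk h => hK (h ▸ hk))]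
          exact ENNReal.sum_le_tsum _
  have h2 : ENNReal.ofReal ((2 * (N : ℝ) ^ θ) ^ d) * τ =
      ENNReal.ofReal ((2 * (N : ℝ) ^ θ) ^ d * τ.toReal) := by
    rw [ENNReal.ofReal_mul (by positivity), ENNReal.ofReal_toReal hα.ne]
  rw [h2] at key
  have h3 := (ENNReal.ofReal_le_ofReal_iff (by positivity)).1 key
  refine h3.trans (le_of_eq ?_)
  rw [mul_pow]
  ring

end ExponentialSums

/-! ### Upper bounds for visits to boxes over cubes -/

section BoxCounts

variable {d m : ℕ}

/-- The orbit `n ↦ w - α n` of the translation action of `ℤ^d` on the torus. -/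
def orbitPoint (α : Fin m → Fin d → ℝ) (w : Fin m → ℝ) (n : Fin d → ℤ) (i : Fin m) : ℝ :=
  w i - ∑ j, α i j * n j

open Classical in
/-- The indicator function of the visits of an orbit to the box `∏ i, [a i, b i)`. -/
def boxVisit (α : Fin m → Fin d → ℝ) (w a b : Fin m → ℝ) (n : Fin d → ℤ) : ℝ :=
  if ∀ i, Int.fract (orbitPoint α w n i) ∈ Ico (a i) (b i) then 1 else 0

theorem boxVisit_eq_prod [∀ x a b, Decidable (x ∈ Ico (a : ℝ) b)]
    (α : Fin m → Fin d → ℝ) (w a b : Fin m → ℝ) (n : Fin d → ℤ) :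
    boxVisit α w a b n =
      ∏ i, if Int.fract (orbitPoint α w n i) ∈ Ico (a i) (b i) then (1 : ℝ) else 0 := by
  rw [boxVisit, Finset.prod_ite_zero]
  simp

theorem prod_add_le_prod_add {ι : Type*} (s : Finset ι) (ℓ : ι → ℝ) {δ : ℝ} (hδ : 0 ≤ δ)
    (hδ1 : δ ≤ 1) (h0 : ∀ i, 0 ≤ ℓ i) (h1 : ∀ i, ℓ i ≤ 1) :
    ∏ i ∈ s, (ℓ i + δ) ≤ ∏ i ∈ s, ℓ i + 3 ^ s.card * δ := by
  classical
  induction s using Finset.induction_on with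
  | empty => simp [hδ]
  | insert i s hi ih =>
    rw [Finset.prod_insert hi, Finset.prod_insert hi, Finset.card_insert_of_notMem hi, pow_succ]
    have hp0 : 0 ≤ ∏ i ∈ s, ℓ i := Finset.prod_nonneg fun i _ => h0 i
    have hp1 : ∏ i ∈ s, ℓ i ≤ 1 := Finset.prod_le_one (fun i _ => h0 i) fun i _ => h1 i
    have h3 : (1 : ℝ) ≤ 3 ^ s.card := one_le_pow₀ (by norm_num)
    have h4 : 0 ≤ ℓ i + δ := add_nonneg (h0 i) hδ
    have h5 : ℓ i + δ ≤ 2 := by linarith [h1 i]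
    calc (ℓ i + δ) * ∏ i ∈ s, (ℓ i + δ) ≤ (ℓ i + δ) * (∏ i ∈ s, ℓ i + 3 ^ s.card * δ) :=
          mul_le_mul_of_nonneg_left ih h4
      _ = ℓ i * ∏ i ∈ s, ℓ i + δ * ∏ i ∈ s, ℓ i + (ℓ i + δ) * (3 ^ s.card * δ) := by ring
      _ ≤ ℓ i * ∏ i ∈ s, ℓ i + δ * 3 ^ s.card + 2 * (3 ^ s.card * δ) := by
          gcongr
          linarith
      _ = _ := by ring

/-- The product of the one-dimensional majorants is expanded in characters. The zero frequency gives
the main term; the others are exponential sums controlled by the hypothesis on `T`. -/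
theorem sum_boxVisit_le_of_majorant {θ : ℝ} (hθ : 0 < θ) (hθ1 : θ < 1) {α : Fin m → Fin d → ℝ}
    {T : ℝ} (hT : ∀ (N : ℕ) (c : Fin d → ℤ) (K : Finset (Fin m → ℤ)), 0 ∉ K →
      ∑ k ∈ K, (∏ i, freqWeight θ (k i)) *
        ‖∑ n ∈ gridCube c N, unitExp (∑ j, n j * -(∑ i, k i * α i j))‖ ≤ T * ((N : ℝ) ^ θ) ^ d)
    {a b : Fin m → ℝ} (ha : ∀ i, 0 ≤ a i) (hab : ∀ i, a i ≤ b i) (hb : ∀ i, b i ≤ 1)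
    {δ : ℝ} (hδ : 0 < δ) (hδ1 : δ ≤ 1) (w : Fin m → ℝ) (N : ℕ) (c : Fin d → ℤ) :
    ∑ n ∈ gridCube c N, boxVisit α w a b n ≤
      N ^ d * ∏ i, (b i - a i + δ) + (2 * δ ^ (-θ)) ^ m * (T * ((N : ℝ) ^ θ) ^ d) := by
  classical
  choose γ g hγ0 hγ hg hle using fun i =>
    exists_fourier_majorant (ha i) (hab i) (hb i) hδ hδ1 hθ hθ1
  have hδθ : 1 ≤ δ ^ (-θ) := Real.one_le_rpow_of_pos_of_le_one_of_nonpos hδ hδ1 (by linarith)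
  -- The factor `2` covers the coefficient `b - a + δ ≤ 2` at `k = 0`.
  have hγ' : ∀ i k, ‖γ i k‖ ≤ 2 * δ ^ (-θ) * freqWeight θ k := by
    intro i k
    by_cases hk : k = 0
    · rw [hk, hγ0, freqWeight, if_pos rfl, Complex.norm_real, Real.norm_eq_abs,
        abs_of_nonneg (by linarith [hab i])]
      linarith [ha i, hb i]
    · refine (hγ i k hk).trans ?_
      rw [freqWeight, if_neg hk]
      have : 0 ≤ |(k : ℝ)| ^ (-(1 + θ)) := by positivity
      nlinarith
  set x := orbitPoint α w with hx
  set R : ℝ := (2 * δ ^ (-θ)) ^ m * (T * ((N : ℝ) ^ θ) ^ d) with hR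
  -- Truncating all the series to one finite set of frequencies keeps the expansion finite; the
  -- bound is uniform in `K` and passes to the limit.
  set P : Finset ℤ → ℂ := fun K =>
    ∑ n ∈ gridCube c N, ∏ i, ∑ k ∈ K, γ i k * unitExp (k * x n i) with hP
  set M : ℝ := N ^ d * ∏ i, (b i - a i + δ) with hM
  have hPK : ∀ K : Finset ℤ, 0 ∈ K → ‖P K - (M : ℂ)‖ ≤ R := by
    intro K hK
    have e1 : P K = ∑ k ∈ Fintype.piFinset fun _ : Fin m => K,
        (∏ i, γ i (k i)) * ∑ n ∈ gridCube c N, unitExp (∑ i, k i * x n i) := by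
      simp only [hP, Finset.prod_univ_sum, Finset.prod_mul_distrib, ← unitExp_sum]
      rw [Finset.sum_comm]
      simp only [Finset.mul_sum]
    have h0 : (0 : Fin m → ℤ) ∈ Fintype.piFinset fun _ : Fin m => K := by
      rw [Fintype.mem_piFinset]; exact fun _ => hK
    -- The starting point `w` contributes only a factor of modulus one, so the estimate is uniform
    -- in the orbit.
    have e2 : ∀ k : Fin m → ℤ, ‖∑ n ∈ gridCube c N, unitExp (∑ i, k i * x n i)‖ =
        ‖∑ n ∈ gridCube c N, unitExp (∑ j, n j * -(∑ i, k i * α i j))‖ := by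
      intro k
      have : ∀ n, ∑ i, k i * x n i = ∑ i, k i * w i + ∑ j, n j * -(∑ i, k i * α i j) := by
        intro n
        simp only [hx, orbitPoint, mul_sub, Finset.sum_sub_distrib, Finset.mul_sum, mul_neg,
          Finset.sum_neg_distrib]
        rw [Finset.sum_comm, sub_eq_add_neg]
        congr 2
        exact Finset.sum_congr rfl fun j _ => Finset.sum_congr rfl fun i _ => by ring
      simp_rw [this, unitExp_add]
      rw [← Finset.mul_sum, norm_mul, norm_unitExp, one_mul]
    have e3 : (∏ i, γ i ((0 : Fin m → ℤ) i)) *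
        ∑ n ∈ gridCube c N, unitExp (∑ i, ((0 : Fin m → ℤ) i : ℝ) * x n i) = (M : ℂ) := by
      simp only [Pi.zero_apply, hγ0, Int.cast_zero, zero_mul, Finset.sum_const_zero, unitExp_zero,
        Finset.sum_const, card_gridCube, Fintype.card_fin, hM]
      push_cast
      simp [mul_comm]
    rw [e1, ← Finset.add_sum_erase _ _ h0, e3, add_sub_cancel_left]
    refine (norm_sum_le _ _).trans ?_
    calc _ ≤ ∑ k ∈ (Fintype.piFinset fun _ : Fin m => K).erase 0,
          (2 * δ ^ (-θ)) ^ m * ((∏ i, freqWeight θ (k i)) *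
            ‖∑ n ∈ gridCube c N, unitExp (∑ j, n j * -(∑ i, k i * α i j))‖) := by
          refine Finset.sum_le_sum fun k _ => ?_
          rw [norm_mul, e2, ← mul_assoc]
          refine mul_le_mul_of_nonneg_right ?_ (norm_nonneg _)
          rw [norm_prod]
          refine (Finset.prod_le_prod (fun i _ => norm_nonneg _) fun i _ => hγ' i (k i)).trans ?_
          rw [Finset.prod_mul_distrib]
          simp
      _ ≤ R := by
          rw [← Finset.mul_sum]
          exact mul_le_mul_of_nonneg_left (hT N c _ (Finset.notMem_erase _ _)) (by positivity)
  have hlim : Tendsto P atTop (𝓝 ((∑ n ∈ gridCube c N, ∏ i, g i (x n i) : ℝ) : ℂ)) := by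
    push_cast
    refine tendsto_finsetSum _ fun n _ => tendsto_finsetProd _ fun i _ => ?_
    have := hg i (x n i)
    rwa [HasSum, SummationFilter.unconditional_filter] at this
  have hfin : ‖((∑ n ∈ gridCube c N, ∏ i, g i (x n i) : ℝ) : ℂ) - (M : ℂ)‖ ≤ R := by
    refine le_of_tendsto ((hlim.sub_const _).norm) ?_
    filter_upwards [eventually_ge_atTop ({0} : Finset ℤ)] with K hK
    exact hPK K (hK (Finset.mem_singleton_self 0))
  rw [← Complex.ofReal_sub, Complex.norm_real, Real.norm_eq_abs] at hfin
  have h1 : ∑ n ∈ gridCube c N, boxVisit α w a b n ≤ ∑ n ∈ gridCube c N, ∏ i, g i (x n i) := by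
    refine Finset.sum_le_sum fun n _ => ?_
    rw [boxVisit_eq_prod]
    refine Finset.prod_le_prod (fun i _ => ?_) fun i _ => ?_
    · split_ifs <;> norm_num
    · convert hle i (x n i)
  linarith [(abs_le.1 hfin).2]

theorem sum_boxVisit_le (hd : 2 ≤ d) {θ : ℝ} (hθ : θ = 1 / (2 * (2 * m + d)))
    {α : Fin m → Fin d → ℝ}
    {T : ℝ} (hT0 : 0 ≤ T) (hT : ∀ (N : ℕ) (c : Fin d → ℤ) (K : Finset (Fin m → ℤ)), 0 ∉ K →
      ∑ k ∈ K, (∏ i, freqWeight θ (k i)) *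
        ‖∑ n ∈ gridCube c N, unitExp (∑ j, n j * -(∑ i, k i * α i j))‖ ≤ T * ((N : ℝ) ^ θ) ^ d)
    {a b : Fin m → ℝ} (ha : ∀ i, 0 ≤ a i) (hab : ∀ i, a i ≤ b i) (hb : ∀ i, b i ≤ 1)
    (w : Fin m → ℝ) {N : ℕ} (hN : 0 < N) (c : Fin d → ℤ) :
    ∑ n ∈ gridCube c N, boxVisit α w a b n ≤
      N ^ d * ∏ i, (b i - a i) + (3 ^ m + 2 ^ m * T) * ((N : ℝ) ^ d / (N * √N)) := by
  have hd' : (2 : ℝ) ≤ d := by exact_mod_cast hd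
  have hm' : (0 : ℝ) ≤ m := by positivity
  have hθ0 : 0 < θ := by rw [hθ]; positivity
  have hθ1 : θ < 1 := by
    rw [hθ, div_lt_one (by positivity)]
    linarith
  have hNr : (0 : ℝ) < N := by exact_mod_cast hN
  have hN1 : (1 : ℝ) ≤ N := by exact_mod_cast hN
  -- With this `δ` smoothing costs `N^(d-2)`, and the value of `θ` is the one for which `N^(θ (2m +
  -- d))` equals `√N`.
  set δ : ℝ := ((N : ℝ) ^ 2)⁻¹ with hδ
  have hδ0 : 0 < δ := by positivity
  have hδ1 : δ ≤ 1 := inv_le_one_of_one_le₀ (one_le_pow₀ hN1)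
  have h := sum_boxVisit_le_of_majorant hθ0 hθ1 hT ha hab hb hδ0 hδ1 w N c
  have hsq : √(N : ℝ) * √N = N := Real.mul_self_sqrt hNr.le
  have hs1 : 1 ≤ √(N : ℝ) := Real.one_le_sqrt.2 hN1
  have hsN : √(N : ℝ) ≤ N := by nlinarith
  have hs0 : 0 < √(N : ℝ) := by positivity
  have e1 : (N : ℝ) ^ d * δ ≤ (N : ℝ) ^ d / (N * √N) := by
    rw [hδ, ← div_eq_mul_inv]
    refine div_le_div_of_nonneg_left (by positivity) (by positivity) ?_
    rw [sq]
    exact mul_le_mul_of_nonneg_left hsN hNr.le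
  have e2 : (δ ^ (-θ)) ^ m * ((N : ℝ) ^ θ) ^ d = √N := by
    rw [hδ, Real.inv_rpow (by positivity), Real.rpow_neg (by positivity), inv_inv,
      ← Real.rpow_natCast, ← Real.rpow_natCast, ← Real.rpow_natCast, ← Real.rpow_mul hNr.le,
      ← Real.rpow_mul (by positivity), ← Real.rpow_mul hNr.le, ← Real.rpow_add hNr, Real.sqrt_eq_rpow]
    congr 1
    rw [hθ]
    push_cast
    field_simp
  -- Here `d ≥ 2` is essential: `N^(1/2) ≤ N^(d - 3/2)`.
  have e3 : √(N : ℝ) ≤ (N : ℝ) ^ d / (N * √N) := by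
    rw [le_div_iff₀ (by positivity)]
    calc √(N : ℝ) * (N * √N) = (√N * √N) * N := by ring
      _ = (N : ℝ) ^ 2 := by rw [hsq, sq]
      _ ≤ (N : ℝ) ^ d := pow_le_pow_right₀ hN1 hd
  have e4 := prod_add_le_prod_add Finset.univ (fun i => b i - a i) hδ0.le hδ1
    (fun i => sub_nonneg.2 (hab i)) (fun i => by linarith [ha i, hb i])
  rw [Finset.card_univ, Fintype.card_fin] at e4
  calc _ ≤ _ := h
    _ ≤ N ^ d * (∏ i, (b i - a i) + 3 ^ m * δ) +
        2 ^ m * T * ((δ ^ (-θ)) ^ m * ((N : ℝ) ^ θ) ^ d) := by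
        refine add_le_add (mul_le_mul_of_nonneg_left e4 (by positivity)) (le_of_eq ?_)
        rw [mul_pow]; ring
    _ = N ^ d * ∏ i, (b i - a i) + (3 ^ m * ((N : ℝ) ^ d * δ) + 2 ^ m * T * √N) := by
        rw [e2]; ring
    _ ≤ N ^ d * ∏ i, (b i - a i) + (3 ^ m * ((N : ℝ) ^ d / (N * √N)) +
        2 ^ m * T * ((N : ℝ) ^ d / (N * √N))) := by
        gcongr
    _ = _ := by ring

end BoxCounts

/-! ### Two-sided discrepancy bounds -/

section Discrepancy

variable {d m : ℕ}

/-- Cutting each unit interval at `a i` and `b i` partitions the torus into `3^m` boxes. Visits and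
volumes have the same total, so an excess of at most `E` in each other box limits the deficit in the
given one. -/
theorem abs_sum_boxVisit_sub_le {α : Fin m → Fin d → ℝ} {w : Fin m → ℝ} {X : Finset (Fin d → ℤ)}
    {E : ℝ} (h : ∀ a b : Fin m → ℝ, (∀ i, 0 ≤ a i) → (∀ i, a i ≤ b i) → (∀ i, b i ≤ 1) →
      ∑ n ∈ X, boxVisit α w a b n ≤ X.card * ∏ i, (b i - a i) + E)
    {a b : Fin m → ℝ} (ha : ∀ i, 0 ≤ a i) (hab : ∀ i, a i ≤ b i) (hb : ∀ i, b i ≤ 1) :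
    |∑ n ∈ X, boxVisit α w a b n - X.card * ∏ i, (b i - a i)| ≤ 3 ^ m * E := by
  classical
  set lo : (Fin m → Fin 3) → Fin m → ℝ := fun σ i => ![0, a i, b i] (σ i) with hlo
  set hi : (Fin m → Fin 3) → Fin m → ℝ := fun σ i => ![a i, b i, 1] (σ i) with hhi
  have hbox : ∀ σ, ∑ n ∈ X, boxVisit α w (lo σ) (hi σ) n ≤
      X.card * ∏ i, (hi σ i - lo σ i) + E := by
    intro σ
    refine h _ _ (fun i => ?_) (fun i => ?_) (fun i => ?_) <;> simp only [hlo, hhi] <;>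
      generalize σ i = s <;> have := ha i <;> have := hab i <;> have := hb i <;> fin_cases s <;>
      simp <;> linarith
  have hone : ∀ n, ∑ σ, boxVisit α w (lo σ) (hi σ) n = 1 := by
    intro n
    simp_rw [boxVisit_eq_prod]
    have := Finset.prod_univ_sum (fun _ : Fin m => (Finset.univ : Finset (Fin 3))) (fun i s =>
      if Int.fract (orbitPoint α w n i) ∈ Ico (![0, a i, b i] s) (![a i, b i, 1] s)
        then (1 : ℝ) else 0)
    rw [Fintype.piFinset_univ] at this
    rw [← this]
    refine Finset.prod_eq_one fun i _ => ?_
    have h0 := Int.fract_nonneg (orbitPoint α w n i)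
    have h1 := Int.fract_lt_one (orbitPoint α w n i)
    have := hab i
    rw [Fin.sum_univ_three]
    simp only [Matrix.cons_val_zero, Matrix.cons_val_one, Matrix.cons_val, mem_Ico]
    by_cases c1 : Int.fract (orbitPoint α w n i) < a i
    · have c2 : ¬ a i ≤ Int.fract (orbitPoint α w n i) := not_le.2 c1
      have c3 : ¬ b i ≤ Int.fract (orbitPoint α w n i) := not_le.2 (c1.trans_le this)
      simp [c1, c2, c3, h0]
    · by_cases c2 : Int.fract (orbitPoint α w n i) < b i
      · have c3 : ¬ b i ≤ Int.fract (orbitPoint α w n i) := not_le.2 c2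
        simp [c1, c2, c3, not_lt.1 c1]
      · simp [c1, c2, not_lt.1 c2, h1]
  have hvol : ∑ σ, ∏ i, (hi σ i - lo σ i) = 1 := by
    have := Finset.prod_univ_sum (fun _ : Fin m => (Finset.univ : Finset (Fin 3))) (fun i s =>
      ![a i, b i, 1] s - ![0, a i, b i] s)
    rw [Fintype.piFinset_univ] at this
    rw [← this]
    refine Finset.prod_eq_one fun i _ => ?_
    simp [Fin.sum_univ_three]
  have hS : ∑ σ, ∑ n ∈ X, boxVisit α w (lo σ) (hi σ) n = X.card := by
    rw [Finset.sum_comm]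
    simp [hone]
  have hV : ∑ σ, (X.card : ℝ) * ∏ i, (hi σ i - lo σ i) = X.card := by
    rw [← Finset.mul_sum, hvol, mul_one]
  have hE : 0 ≤ E := by
    have := h 0 0 (fun _ => le_rfl) (fun _ => le_rfl) (fun _ => zero_le_one)
    have h2 := h 0 1 (fun _ => le_rfl) (fun _ => zero_le_one) (fun _ => le_rfl)
    have h3 : ∀ n, boxVisit α w 0 1 n = 1 := by
      intro n
      simp [boxVisit, Int.fract_nonneg, Int.fract_lt_one]
    simp only [h3, Finset.sum_const, nsmul_eq_mul, mul_one, Pi.one_apply, Pi.zero_apply, sub_zero,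
      Finset.prod_const_one] at h2
    linarith
  set σ₀ : Fin m → Fin 3 := fun _ => 1 with hσ₀
  have e0 : lo σ₀ = a := by ext i; simp [hlo, hσ₀]
  have e1 : hi σ₀ = b := by ext i; simp [hhi, hσ₀]
  have hup := hbox σ₀
  have hlow : X.card * ∏ i, (hi σ₀ i - lo σ₀ i) - ∑ n ∈ X, boxVisit α w (lo σ₀) (hi σ₀) n ≤
      (3 ^ m - 1) * E := by
    have h1 := Finset.add_sum_erase Finset.univ
      (fun σ => ∑ n ∈ X, boxVisit α w (lo σ) (hi σ) n) (Finset.mem_univ σ₀)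
    have h2 := Finset.add_sum_erase Finset.univ
      (fun σ => (X.card : ℝ) * ∏ i, (hi σ i - lo σ i)) (Finset.mem_univ σ₀)
    have h3 : ∑ σ ∈ Finset.univ.erase σ₀, ∑ n ∈ X, boxVisit α w (lo σ) (hi σ) n ≤
        ∑ σ ∈ Finset.univ.erase σ₀, ((X.card : ℝ) * ∏ i, (hi σ i - lo σ i) + E) :=
      Finset.sum_le_sum fun σ _ => hbox σ
    rw [Finset.sum_add_distrib, Finset.sum_const, Finset.card_erase_of_mem (Finset.mem_univ _),
      Finset.card_univ, Fintype.card_pi, Finset.prod_const, Finset.card_univ, Fintype.card_fin,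
      Fintype.card_fin, nsmul_eq_mul, Nat.cast_sub (Nat.one_le_pow _ _ (by norm_num))] at h3
    push_cast at h3
    linarith
  rw [e0, e1] at hup hlow
  have h3 : (1 : ℝ) ≤ 3 ^ m := one_le_pow₀ (by norm_num)
  rw [abs_le]
  constructor <;> nlinarith

/-- For almost every linear map, the visits to boxes of the orbits of the associated action of
`ℤ^d` on the torus are uniformly distributed, with an error bounded by the size of the boundary of
the set of times. -/
theorem ae_exists_discrepancy_le (hd : 2 ≤ d) :
    ∀ᵐ α : Fin m → Fin d → ℝ, ∃ C : ℝ, 0 ≤ C ∧ ∀ (w a b : Fin m → ℝ), (∀ i, 0 ≤ a i) →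
      (∀ i, a i ≤ b i) → (∀ i, b i ≤ 1) → ∀ X : Finset (Fin d → ℤ), ∃ Q : Finset (Fin d → ℤ),
      |∑ n ∈ X, boxVisit α w a b n - X.card * ∏ i, (b i - a i)| ≤ C * (cutEdges Q X).card := by
  set θ : ℝ := 1 / (2 * (2 * m + d)) with hθ
  have hd' : (2 : ℝ) ≤ d := by exact_mod_cast hd
  have hm' : (0 : ℝ) ≤ m := by positivity
  have hθ0 : 0 < θ := by rw [hθ]; positivity
  have hθ1 : θ < 1 := by
    rw [hθ, div_lt_one (by positivity)]
    linarith
  have : Nonempty (Fin d) := ⟨⟨0, by omega⟩⟩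
  filter_upwards [ae_exists_sum_norm_unitExp_le (d := d) (m := m) hθ0 hθ1] with α ⟨T, hT0, hT⟩
  -- The error `N^(d - 3/2)` at `N = 2^J` is `N^(d-1) r^J`.
  set r : ℝ := (√2)⁻¹ with hr
  have hr0 : 0 ≤ r := by positivity
  have hr1 : r < 1 := inv_lt_one_of_one_lt₀ (Real.lt_sqrt_of_sq_lt (by norm_num))
  set C : ℝ := 3 ^ m * (3 ^ m + 2 ^ m * T) with hC
  have hr1' : 0 < 1 - r := sub_pos.2 hr1
  refine ⟨8 * 2 ^ Fintype.card (Fin d) * C * (1 - r)⁻¹, by positivity, ?_⟩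
  intro w a b ha hab hb X
  set v := ∏ i, (b i - a i) with hv
  have hD : ∀ (J : ℕ) (c : Fin d → ℤ), |∑ n ∈ gridCube c (2 ^ J), (boxVisit α w a b n - v)| *
      2 ^ J ≤ C * (2 ^ J) ^ Fintype.card (Fin d) * r ^ J := by
    intro J c
    rw [Finset.sum_sub_distrib, Finset.sum_const, nsmul_eq_mul]
    have hcard : ((gridCube c (2 ^ J)).card : ℝ) = ((2 ^ J : ℕ) : ℝ) ^ d := by
      rw [card_gridCube, Fintype.card_fin]; push_cast; ring
    have key := abs_sum_boxVisit_sub_le (α := α) (w := w) (X := gridCube c (2 ^ J))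
      (fun a b ha hab hb => by
        rw [hcard]
        exact sum_boxVisit_le hd hθ hT0 hT ha hab hb w (by positivity) c) ha hab hb
    have hsq : √((2 ^ J : ℕ) : ℝ) = √2 ^ J := by
      push_cast
      have h2 : (√2 ^ J) ^ 2 = (2 : ℝ) ^ J := by
        rw [← pow_mul, mul_comm, pow_mul, Real.sq_sqrt (by norm_num)]
      rw [← h2, Real.sqrt_sq (by positivity)]
    rw [hsq] at key
    refine (mul_le_mul_of_nonneg_right key (by positivity)).trans (le_of_eq ?_)
    rw [Fintype.card_fin, hr, inv_pow, hC]
    push_cast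
    field_simp
  obtain ⟨Q, hQ⟩ := exists_abs_sum_le_cutEdges (fun n => boxVisit α w a b n - v) C r hr0 hr1 hD X
  refine ⟨Q, ?_⟩
  rwa [Finset.sum_sub_distrib, Finset.sum_const, nsmul_eq_mul] at hQ

end Discrepancy

/-! ### Regular cut and project sets as orbits on the torus -/

section CutProject

variable {d m : ℕ}

/-- An integer vector as a real vector. -/
def realVec {ι : Type*} (n : ι → ℤ) : ι → ℝ := fun i => n i

theorem realVec_injective {ι : Type*} : Function.Injective (realVec (ι := ι)) := fun _ _ h =>
  funext fun i => Int.cast_injective (α := ℝ) (congrFun h i)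

/-- The lattice vector with integer coordinates `(v, u)`. -/
def latticeVec (v : Fin d → ℤ) (u : Fin m → ℤ) : TotalSpace d m := (realVec v, realVec u)

theorem mem_integerLattice {x : TotalSpace d m} :
    x ∈ integerLattice d m ↔ ∃ v u, x = latticeVec v u := by
  constructor
  · rintro ⟨h1, h2⟩
    choose v hv using h1
    choose u hu using h2
    exact ⟨v, u, Prod.ext (funext hv) (funext hu)⟩
  · rintro ⟨v, u, rfl⟩
    exact ⟨fun i => ⟨v i, rfl⟩, fun i => ⟨u i, rfl⟩⟩

theorem orbitPoint_eq (α : Fin m → Fin d → ℝ) (w : Fin m → ℝ) (n : Fin d → ℤ) (i : Fin m) :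
    orbitPoint α w n i = w i - linMap α (realVec n) i := rfl

theorem orbitPoint_add (α : Fin m → Fin d → ℝ) (w : Fin m → ℝ) (n v : Fin d → ℤ) :
    orbitPoint α w (n + v) = orbitPoint α (orbitPoint α w n) v := by
  ext i
  simp only [orbitPoint, Pi.add_apply, Int.cast_add, mul_add, Finset.sum_add_distrib]
  ring

theorem boxVisit_add (α : Fin m → Fin d → ℝ) (w a b : Fin m → ℝ) (n v : Fin d → ℤ) :
    boxVisit α w a b (n + v) = boxVisit α (orbitPoint α w n) a b v := by
  simp only [boxVisit, orbitPoint_add]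

theorem mem_physicalSpace {L : (Fin d → ℝ) →ₗ[ℝ] (Fin m → ℝ)} {x : TotalSpace d m} :
    x ∈ physicalSpace L ↔ x.2 = L x.1 := by
  rw [physicalSpace, LinearMap.mem_graph_iff]

namespace CubicalScheme

section Slice

variable {L : (Fin d → ℝ) →ₗ[ℝ] (Fin m → ℝ)} (S : CubicalScheme L)

theorem projStar_eq_sub (x : TotalSpace d m) : S.projStar x = x - S.proj x := by
  rw [projStar, proj, Submodule.projection_eq_self_sub_projection]

theorem proj_mem (x : TotalSpace d m) : S.proj x ∈ physicalSpace L :=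
  Submodule.projection_apply_mem _ _

theorem proj_of_mem {x : TotalSpace d m} (hx : x ∈ physicalSpace L) : S.proj x = x :=
  Submodule.projection_apply_of_mem_left _ hx

/-- `π*` changes a vector only by an element of `E`, so adding `E` makes the slice independent of
`F_π`. -/
theorem mem_slice {x : TotalSpace d m} :
    x ∈ S.slice ↔ ∀ i, x.2 i - L x.1 i ∈ Icc (0 : ℝ) 1 := by
  constructor
  · rintro ⟨_, ⟨f, ⟨hf1, hf2⟩, rfl⟩, e, he, rfl⟩ i
    have h1 : (e - S.proj f) ∈ physicalSpace L := sub_mem he (S.proj_mem f)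
    rw [mem_physicalSpace] at h1
    have h2 : S.projStar f + e = f + (e - S.proj f) := by rw [projStar_eq_sub]; abel
    beta_reduce
    rw [h2, Prod.snd_add, Prod.fst_add, hf1, zero_add, h1, Pi.add_apply, add_sub_cancel_right]
    exact hf2 i
  · intro hx
    refine ⟨S.projStar (0, x.2 - L x.1), ⟨_, ⟨rfl, hx⟩, rfl⟩,
      x - S.projStar (0, x.2 - L x.1), ?_, add_sub_cancel _ _⟩
    have h1 : x - S.projStar (0, x.2 - L x.1) =
        (x - (0, x.2 - L x.1)) + S.proj (0, x.2 - L x.1) := by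
      rw [projStar_eq_sub]; abel
    rw [h1]
    refine add_mem ?_ (S.proj_mem _)
    rw [mem_physicalSpace]
    simp

theorem injOn_shiftedLattice (s : TotalSpace d m) : InjOn S.proj (shiftedLattice s) := by
  rintro _ ⟨x, hx, rfl⟩ _ ⟨y, hy, rfl⟩ h
  simp only [map_add, add_left_inj] at h
  rw [S.injOn hx hy h]

theorem lift_proj {s x : TotalSpace d m} (hx : x ∈ shiftedLattice s) : S.lift s (S.proj x) = x :=
  (S.injOn_shiftedLattice s).leftInvOn_invFunOn hx

end Slice

variable {α : Fin m → Fin d → ℝ} (S : CubicalScheme (linMap α))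

/-- The starting point of the orbit that describes `Y_s`. -/
def _root_.orbitBase (α : Fin m → Fin d → ℝ) (s : TotalSpace d m) : Fin m → ℝ :=
  s.2 - linMap α s.1

/-- The point of `ℤ^k + s` above `n + s` that lies in the slice. -/
def _root_.slicePoint (α : Fin m → Fin d → ℝ) (s : TotalSpace d m) (n : Fin d → ℤ) :
    TotalSpace d m :=
  latticeVec n (fun i => -⌊orbitPoint α (orbitBase α s) n i⌋) + s

theorem slicePoint_mem_shiftedLattice (s : TotalSpace d m) (n : Fin d → ℤ) :
    slicePoint α s n ∈ shiftedLattice s :=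
  ⟨_, mem_integerLattice.2 ⟨_, _, rfl⟩, rfl⟩

theorem slicePoint_height (s : TotalSpace d m) (n : Fin d → ℤ) (i : Fin m) :
    (slicePoint α s n).2 i - linMap α (slicePoint α s n).1 i =
      Int.fract (orbitPoint α (orbitBase α s) n i) := by
  simp only [slicePoint, latticeVec, Prod.snd_add, Prod.fst_add, map_add, Pi.add_apply, realVec]
  rw [Int.fract]
  generalize ⌊orbitPoint α (orbitBase α s) n i⌋ = F
  rw [orbitPoint_eq]
  simp only [orbitBase, Pi.sub_apply]
  push_cast
  ring

theorem slicePoint_mem_slice (s : TotalSpace d m) (n : Fin d → ℤ) :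
    slicePoint α s n ∈ S.slice := by
  rw [S.mem_slice]
  intro i
  rw [slicePoint_height]
  exact ⟨Int.fract_nonneg _, (Int.fract_lt_one _).le⟩

/-- At height `0` in coordinate `i`, arbitrarily small downward moves leave the slice, so the
lattice point would lie on its frontier. -/
theorem IsRegular.fract_pos {s : TotalSpace d m} (hs : S.IsRegular s) (n : Fin d → ℤ) (i : Fin m) :
    0 < Int.fract (orbitPoint α (orbitBase α s) n i) := by
  refine lt_of_le_of_ne (Int.fract_nonneg _) fun h0 => ?_
  have hp := S.slicePoint_mem_slice s n
  set p := slicePoint α s n with hpdef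
  have hfr : p ∈ frontier S.slice := by
    refine ⟨subset_closure hp, fun hi => ?_⟩
    have ht : Tendsto (fun t : ℝ => p - t • ((0, Pi.single i 1) : TotalSpace d m)) (𝓝[>] 0)
        (𝓝 p) := by
      have h1 : Tendsto (fun t : ℝ => p - t • ((0, Pi.single i 1) : TotalSpace d m)) (𝓝 0)
          (𝓝 (p - (0 : ℝ) • ((0, Pi.single i 1) : TotalSpace d m))) :=
        (by fun_prop : Continuous fun t : ℝ =>
          p - t • ((0, Pi.single i 1) : TotalSpace d m)).tendsto 0
      rw [zero_smul, sub_zero] at h1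
      exact h1.mono_left nhdsWithin_le_nhds
    have hev := ht.eventually (isOpen_interior.mem_nhds hi)
    obtain ⟨t, h1, h2⟩ := (hev.and self_mem_nhdsWithin).exists
    have h3 := (S.mem_slice.1 (interior_subset h1) i).1
    have h4 := slicePoint_height (α := α) s n i
    rw [← h0, ← hpdef] at h4
    simp only [Prod.snd_sub, Prod.fst_sub, Prod.smul_mk, smul_zero, sub_zero, Pi.sub_apply,
      Pi.smul_apply, Pi.single_eq_same, smul_eq_mul, mul_one] at h3
    have h2 : 0 < t := h2
    linarith
  have : p ∈ frontier S.slice ∩ shiftedLattice s := ⟨hfr, slicePoint_mem_shiftedLattice s n⟩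
  rw [hs] at this
  exact this

/-- Two integer translates of a height can both lie in the closed interval `[0, 1]` only at the end
points, which regularity excludes. -/
theorem slice_inter_shiftedLattice {s : TotalSpace d m} (hs : S.IsRegular s) :
    S.slice ∩ shiftedLattice s = range (slicePoint α s) := by
  ext x
  constructor
  · rintro ⟨hx, ⟨y, hy, rfl⟩⟩
    obtain ⟨n, z, rfl⟩ := mem_integerLattice.1 hy
    refine ⟨n, ?_⟩
    rw [slicePoint]
    congr 2
    ext i
    have h1 := S.mem_slice.1 hx i
    have h2 := IsRegular.fract_pos S hs n i
    have h3 := Int.fract_lt_one (orbitPoint α (orbitBase α s) n i)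
    have h4 := Int.floor_add_fract (orbitPoint α (orbitBase α s) n i)
    have h5 : (latticeVec n z + s).2 i - linMap α (latticeVec n z + s).1 i =
        z i + orbitPoint α (orbitBase α s) n i := by
      simp only [latticeVec, Prod.snd_add, Prod.fst_add, map_add, Pi.add_apply]
      rw [orbitPoint_eq]
      simp only [realVec, orbitBase, Pi.sub_apply]
      ring
    beta_reduce at h1
    rw [h5] at h1
    have h6 : (z i : ℝ) + ⌊orbitPoint α (orbitBase α s) n i⌋ < 1 := by linarith [h1.2]
    have h7 : -1 < (z i : ℝ) + ⌊orbitPoint α (orbitBase α s) n i⌋ := by linarith [h1.1]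
    have h8 : z i + ⌊orbitPoint α (orbitBase α s) n i⌋ < 1 := by exact_mod_cast h6
    have h9 : -1 < z i + ⌊orbitPoint α (orbitBase α s) n i⌋ := by exact_mod_cast h7
    omega
  · rintro ⟨n, rfl⟩
    exact ⟨S.slicePoint_mem_slice s n, slicePoint_mem_shiftedLattice s n⟩

theorem cutProject_eq_range {s : TotalSpace d m} (hs : S.IsRegular s) :
    S.cutProject s = range fun n => S.proj (slicePoint α s n) := by
  rw [cutProject, S.slice_inter_shiftedLattice hs, ← range_comp]
  rfl

theorem lift_slicePoint (s : TotalSpace d m) (n : Fin d → ℤ) :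
    S.lift s (S.proj (slicePoint α s n)) = slicePoint α s n :=
  S.lift_proj (slicePoint_mem_shiftedLattice s n)

theorem slicePoint_injective (s : TotalSpace d m) : Function.Injective (slicePoint α s) := by
  intro a b h
  have := congrArg Prod.fst h
  simp only [slicePoint, latticeVec, Prod.fst_add, add_left_inj] at this
  exact realVec_injective this

theorem proj_slicePoint_injective (s : TotalSpace d m) :
    Function.Injective fun n => S.proj (slicePoint α s n) := fun a b h =>
  slicePoint_injective (α := α) s (S.injOn_shiftedLattice s (slicePoint_mem_shiftedLattice s a)
    (slicePoint_mem_shiftedLattice s b) h)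

/-- The change of the last `m` coordinates on a step by `v`, as a function of the position `x` in
the window. -/
def _root_.heightStep (α : Fin m → Fin d → ℝ) (x : Fin m → ℝ) (v : Fin d → ℤ) : Fin m → ℤ :=
  fun i => -⌊x i - linMap α (realVec v) i⌋

/-- The position in the window of the point of the slice above `n + s`. -/
def _root_.windowPoint (α : Fin m → Fin d → ℝ) (s : TotalSpace d m) (n : Fin d → ℤ) : Fin m → ℝ :=
  fun i => Int.fract (orbitPoint α (orbitBase α s) n i)

/-- The step by `v` sees the base point only through its position in the window; this makes patch
classes functions on the window. -/
theorem slicePoint_add_sub (s : TotalSpace d m) (n v : Fin d → ℤ) :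
    slicePoint α s (n + v) - slicePoint α s n =
      latticeVec v (heightStep α (windowPoint α s n) v) := by
  refine Prod.ext ?_ ?_
  · ext i
    simp [slicePoint, latticeVec, realVec]
  · ext i
    simp only [slicePoint, latticeVec, realVec, add_sub_add_right_eq_sub, Prod.snd_sub,
      Pi.sub_apply, heightStep, windowPoint, orbitPoint_add]
    rw [orbitPoint_eq α (orbitPoint α (orbitBase α s) n) v i]
    set o := orbitPoint α (orbitBase α s) n i
    have : o - linMap α (realVec v) i = Int.fract o - linMap α (realVec v) i + (⌊o⌋ : ℤ) := by
      rw [Int.fract]; ring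
    rw [this, Int.floor_add_intCast]
    push_cast
    ring

/-- The vectors of the lattice that a patch takes into account. -/
def IsPatchVec : PatchType → Set (TotalSpace d m) → ℝ → TotalSpace d m → Prop
  | .typeI, Ω, r, x => S.proj x ∈ r • Ω
  | .typeII, Ω, r, x => rhoProj (linMap α) x ∈ r • Ω

/-- The class of the patch at a point as a function of the position in the window. -/
def windowClass (t : PatchType) (Ω : Set (TotalSpace d m)) (r : ℝ) (x : Fin m → ℝ) :
    Set (TotalSpace d m) :=
  {z | ∃ v, S.IsPatchVec t Ω r (latticeVec v (heightStep α x v)) ∧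
    S.proj (latticeVec v (heightStep α x v)) = z}

theorem patchClass_slicePoint {s : TotalSpace d m} (hs : S.IsRegular s) (t : PatchType)
    (Ω : Set (TotalSpace d m)) (r : ℝ) (n : Fin d → ℤ) :
    S.patchClass s t Ω r (S.proj (slicePoint α s n)) =
      S.windowClass t Ω r (windowPoint α s n) := by
  have hpatch : S.patch s t Ω r (S.proj (slicePoint α s n)) =
      {y' | ∃ n', S.IsPatchVec t Ω r (slicePoint α s n' - slicePoint α s n) ∧
        S.proj (slicePoint α s n') = y'} := by
    ext y'
    cases t
    · simp only [patch, IsPatchVec, mem_ofPred_eq, S.cutProject_eq_range hs]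
      constructor
      · rintro ⟨⟨n', rfl⟩, h⟩
        exact ⟨n', by rwa [map_sub], rfl⟩
      · rintro ⟨n', h, rfl⟩
        exact ⟨⟨n', rfl⟩, by rwa [map_sub] at h⟩
    · simp only [patch, IsPatchVec, mem_ofPred_eq, S.cutProject_eq_range hs]
      constructor
      · rintro ⟨⟨n', rfl⟩, h⟩
        beta_reduce at h
        rw [S.lift_slicePoint, S.lift_slicePoint] at h
        exact ⟨n', h, rfl⟩
      · rintro ⟨n', h, rfl⟩
        refine ⟨⟨n', rfl⟩, ?_⟩
        rw [S.lift_slicePoint, S.lift_slicePoint]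
        exact h
  rw [patchClass, hpatch]
  ext z
  constructor
  · rintro ⟨_, ⟨n', h, rfl⟩, rfl⟩
    refine ⟨n' - n, ?_, ?_⟩ <;> rw [← slicePoint_add_sub, add_sub_cancel]
    · exact h
    · rw [map_sub]
  · rintro ⟨v, h, rfl⟩
    rw [← slicePoint_add_sub] at h ⊢
    exact ⟨_, ⟨n + v, h, rfl⟩, by rw [map_sub]⟩

open Classical in
theorem patchRatio_eq {s : TotalSpace d m} (hs : S.IsRegular s) (t : PatchType)
    (Ω : Set (TotalSpace d m)) (r : ℝ) (P : Set (TotalSpace d m)) (n : Fin d → ℤ)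
    {B : Set (TotalSpace d m)} {X : Finset (Fin d → ℤ)}
    (hB : ∀ v u, latticeVec v u ∈ B ↔ v ∈ X) :
    S.patchRatio s t Ω r P (S.proj (slicePoint α s n)) B =
      (∑ v ∈ X, if S.windowClass t Ω r (windowPoint α s (n + v)) = P then (1 : ℝ) else 0) /
        X.card := by
  have hinj : Function.Injective fun v => S.proj (slicePoint α s (n + v)) := fun a b h =>
    add_left_cancel (S.proj_slicePoint_injective s h)
  have h1 : {y' ∈ S.cutProject s | S.patchClass s t Ω r y' = P ∧
      S.lift s y' - S.lift s (S.proj (slicePoint α s n)) ∈ B} =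
      (fun v => S.proj (slicePoint α s (n + v))) ''
        (X.filter fun v => S.windowClass t Ω r (windowPoint α s (n + v)) = P : Finset _) := by
    ext y'
    rw [mem_image]
    simp only [mem_ofPred_eq, S.cutProject_eq_range hs, Finset.mem_coe, Finset.mem_filter]
    constructor
    · rintro ⟨⟨n', rfl⟩, h2, h3⟩
      beta_reduce at h2 h3
      rw [S.patchClass_slicePoint hs] at h2
      have h4 : n + (n' - n) = n' := by abel
      refine ⟨n' - n, ⟨?_, ?_⟩, ?_⟩
      · rw [S.lift_slicePoint, S.lift_slicePoint, ← h4, slicePoint_add_sub, hB] at h3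
        simpa using h3
      · rw [h4]; exact h2
      · rw [h4]
    · rintro ⟨v, ⟨h2, h3⟩, rfl⟩
      refine ⟨⟨n + v, rfl⟩, ?_, ?_⟩
      · rw [S.patchClass_slicePoint hs]; exact h3
      · rw [S.lift_slicePoint, S.lift_slicePoint, slicePoint_add_sub, hB]; exact h2
  have h2 : {y' ∈ S.cutProject s |
      S.lift s y' - S.lift s (S.proj (slicePoint α s n)) ∈ B} =
      (fun v => S.proj (slicePoint α s (n + v))) '' (X : Set (Fin d → ℤ)) := by
    ext y'
    rw [mem_image]
    simp only [mem_ofPred_eq, S.cutProject_eq_range hs, Finset.mem_coe]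
    constructor
    · rintro ⟨⟨n', rfl⟩, h3⟩
      beta_reduce at h3
      have h4 : n + (n' - n) = n' := by abel
      refine ⟨n' - n, ?_, ?_⟩
      · rw [S.lift_slicePoint, S.lift_slicePoint, ← h4, slicePoint_add_sub, hB] at h3
        simpa using h3
      · rw [h4]
    · rintro ⟨v, h2, rfl⟩
      refine ⟨⟨n + v, rfl⟩, ?_⟩
      rw [S.lift_slicePoint, S.lift_slicePoint, slicePoint_add_sub, hB]; exact h2
  rw [patchRatio, h1, h2, ncard_image_of_injective _ hinj, ncard_image_of_injective _ hinj,
    ncard_coe_finset, ncard_coe_finset, Finset.card_filter]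
  push_cast
  rfl

end CubicalScheme

end CutProject

/-! ### Acceptance domains of patches as unions of boxes -/

section Acceptance

variable {d m : ℕ}

/-- Each prescribed floor confines `x` to a half-open interval, and such intervals are stable under
intersection; an empty one is recorded as `[0, 0)`. -/
theorem exists_Ico_of_floor_eq {ι : Type*} (V : Finset ι) (β : ι → ℝ) (c : ι → ℤ) :
    ∃ a b : ℝ, 0 ≤ a ∧ a ≤ b ∧ b ≤ 1 ∧
      ∀ x ∈ Ico (0 : ℝ) 1, (∀ v ∈ V, -⌊x - β v⌋ = c v) ↔ x ∈ Ico a b := by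
  classical
  induction V using Finset.induction_on with
  | empty => exact ⟨0, 1, le_rfl, zero_le_one, le_rfl, fun x hx => by simpa using hx⟩
  | insert v V hv ih =>
    obtain ⟨a, b, h0, hab, h1, h⟩ := ih
    have key : ∀ x ∈ Ico (0 : ℝ) 1, (∀ u ∈ insert v V, -⌊x - β u⌋ = c u) ↔
        x ∈ Ico (max a (β v - c v)) (min b (β v - c v + 1)) := by
      intro x hx
      rw [Finset.forall_mem_insert, h x hx, neg_eq_iff_eq_neg, Int.floor_eq_iff]
      simp only [mem_Ico, max_le_iff, lt_min_iff]
      push_cast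
      constructor
      · rintro ⟨⟨h2, h3⟩, h4, h5⟩
        exact ⟨⟨h4, by linarith⟩, h5, by linarith⟩
      · rintro ⟨⟨h2, h3⟩, h4, h5⟩
        exact ⟨⟨by linarith, by linarith⟩, h2, h4⟩
    by_cases hle : max a (β v - c v) ≤ min b (β v - c v + 1)
    · exact ⟨_, _, h0.trans (le_max_left _ _), hle, (min_le_left _ _).trans h1, key⟩
    · refine ⟨0, 0, le_rfl, le_rfl, zero_le_one, fun x hx => ?_⟩
      rw [key x hx, Ico_eq_empty fun h => hle h.le]
      simp

/-- The half-open unit cube, which contains all the positions in the window. -/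
def unitWindow (m : ℕ) : Set (Fin m → ℝ) := {x | ∀ i, x i ∈ Ico (0 : ℝ) 1}

/-- The steps from the position `x` by the vectors of a finite set. -/
def stepPattern (α : Fin m → Fin d → ℝ) (V : Finset (Fin d → ℤ)) (x : Fin m → ℝ) :
    V → Fin m → ℤ := fun v => heightStep α x v

theorem exists_box_of_stepPattern_eq (α : Fin m → Fin d → ℝ) (V : Finset (Fin d → ℤ))
    (u : V → Fin m → ℤ) :
    ∃ a b : Fin m → ℝ, (∀ i, 0 ≤ a i) ∧ (∀ i, a i ≤ b i) ∧ (∀ i, b i ≤ 1) ∧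
      ∀ x ∈ unitWindow m, stepPattern α V x = u ↔ ∀ i, x i ∈ Ico (a i) (b i) := by
  choose a b h0 hab h1 h using fun i => exists_Ico_of_floor_eq Finset.univ
    (fun v : V => linMap α (realVec v.1) i) (fun v => u v i)
  refine ⟨a, b, h0, hab, h1, fun x hx => ?_⟩
  rw [funext_iff]
  simp only [← fun i => h i (x i) (hx i), Finset.mem_univ, forall_const]
  rw [forall_comm]
  exact forall_congr' fun v => funext_iff

theorem finite_range_stepPattern (α : Fin m → Fin d → ℝ) (V : Finset (Fin d → ℤ)) :
    (stepPattern α V '' unitWindow m).Finite := by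
  refine (Set.Finite.pi' fun v : V => Set.Finite.pi' fun i : Fin m =>
    Set.finite_Icc (-⌊1 - linMap α (realVec v.1) i⌋) (-⌊-linMap α (realVec v.1) i⌋)).subset ?_
  rintro _ ⟨x, hx, rfl⟩ v i
  simp only [stepPattern, heightStep]
  constructor
  · exact neg_le_neg (Int.floor_le_floor (by linarith [(hx i).2]))
  · exact neg_le_neg (Int.floor_le_floor (by linarith [(hx i).1]))

theorem finite_setOf_norm_realVec_le (B : ℝ) : {v : Fin d → ℤ | ‖realVec v‖ ≤ B}.Finite := by
  refine (Set.Finite.pi' fun i : Fin d => Set.finite_Icc (-⌊B⌋) ⌊B⌋).subset ?_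
  intro v hv i
  have h1 : ‖realVec v i‖ ≤ B := (norm_le_pi_norm _ i).trans hv
  rw [Real.norm_eq_abs, abs_le] at h1
  have h2 : -((v i : ℤ) : ℝ) ≤ B := by have := h1.1; simp only [realVec] at this; linarith
  constructor
  · have : -v i ≤ ⌊B⌋ := Int.le_floor.2 (by push_cast; exact h2)
    linarith
  · exact Int.le_floor.2 h1.2

namespace CubicalScheme

variable {α : Fin m → Fin d → ℝ} (S : CubicalScheme (linMap α))

theorem rhoProj_apply {L : (Fin d → ℝ) →ₗ[ℝ] (Fin m → ℝ)} (x : TotalSpace d m) :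
    rhoProj L x = (x.1, L x.1) := by
  have h1 : x = (x.1, L x.1) + (0, x.2 - L x.1) := by ext <;> simp
  have h2 : ((x.1, L x.1) : TotalSpace d m) ∈ physicalSpace L := mem_physicalSpace.2 rfl
  have h3 : ((0, x.2 - L x.1) : TotalSpace d m) ∈ referenceSpace d m := by simp [referenceSpace]
  conv_lhs => rw [h1]
  rw [map_add, rhoProj, Submodule.projection_apply_of_mem_left _ h2,
    (Submodule.projection_apply_eq_zero_iff _).2 h3, add_zero]

theorem heightStep_eq (x : Fin m → ℝ) (v : Fin d → ℤ) :
    latticeVec v (heightStep α x v) = (realVec v, linMap α (realVec v)) +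
      (0, fun i => Int.fract (x i - linMap α (realVec v) i) - x i) := by
  refine Prod.ext ?_ ?_
  · simp [latticeVec]
  · ext i
    have h : realVec (heightStep α x v) i = -((⌊x i - linMap α (realVec v) i⌋ : ℤ) : ℝ) :=
      Int.cast_neg _
    simp only [latticeVec, h, Prod.snd_add, Pi.add_apply, Int.fract]
    ring

/-- For type I, a step between points of the slice is a vector of `E` over `v` plus a vertical
vector of norm at most `1`, so a bounded image under `π` bounds `v`. For type II, `ρ` retains `v`
itself. -/
theorem finite_patchVecs (t : PatchType) {Ω : Set (TotalSpace d m)} (hΩ : Bornology.IsBounded Ω)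
    (r : ℝ) :
    {v | ∃ x ∈ unitWindow m, S.IsPatchVec t Ω r (latticeVec v (heightStep α x v))}.Finite := by
  obtain ⟨R, hR⟩ := (hΩ.smul₀ r).exists_norm_le
  obtain ⟨M, hM0, hM⟩ := (LinearMap.toContinuousLinearMap S.proj).isBoundedLinearMap.bound
  refine (finite_setOf_norm_realVec_le (R + M)).subset ?_
  rintro v ⟨x, hx, hv⟩
  rw [mem_ofPred_eq]
  cases t
  · have h1 := hR _ hv
    set f : Fin m → ℝ := fun i => Int.fract (x i - linMap α (realVec v) i) - x i with hf
    have hE : ((realVec v, linMap α (realVec v)) : TotalSpace d m) ∈ physicalSpace (linMap α) :=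
      mem_physicalSpace.2 rfl
    rw [heightStep_eq, map_add, S.proj_of_mem hE] at h1
    have h2 : ‖((0, f) : TotalSpace d m)‖ ≤ 1 := by
      rw [Prod.norm_mk, norm_zero, max_le_iff]
      refine ⟨zero_le_one, (pi_norm_le_iff_of_nonneg zero_le_one).2 fun i => ?_⟩
      rw [Real.norm_eq_abs, abs_le]
      have h3 := Int.fract_nonneg (x i - linMap α (realVec v) i)
      have h4 := Int.fract_lt_one (x i - linMap α (realVec v) i)
      have h5 := hx i
      exact ⟨by linarith [h5.2], by linarith [h5.1]⟩
    have h3 : ‖S.proj (0, f)‖ ≤ M := by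
      have := hM (0, f)
      rw [LinearMap.coe_toContinuousLinearMap'] at this
      nlinarith
    calc ‖realVec v‖ ≤ ‖((realVec v, linMap α (realVec v)) : TotalSpace d m)‖ := le_max_left _ _
      _ = ‖((realVec v, linMap α (realVec v)) + S.proj (0, f)) - S.proj (0, f)‖ := by
          rw [add_sub_cancel_right]
      _ ≤ R + M := (norm_sub_le _ _).trans (add_le_add h1 h3)
  · have h1 := hR _ hv
    rw [rhoProj_apply] at h1
    calc ‖realVec v‖ ≤ _ := le_max_left _ _
      _ ≤ R := h1
      _ ≤ R + M := by linarith

open Classical in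
/-- The set of positions in the window at which a given patch class occurs is a finite disjoint
union of boxes, and for patches of type II it is a single box. -/
theorem exists_boxes_of_windowClass (t : PatchType) {Ω : Set (TotalSpace d m)}
    (hΩ : Bornology.IsBounded Ω) (r : ℝ) (P : Set (TotalSpace d m)) :
    ∃ (q : ℕ) (a b : Fin q → Fin m → ℝ), (∀ l i, 0 ≤ a l i) ∧ (∀ l i, a l i ≤ b l i) ∧
      (∀ l i, b l i ≤ 1) ∧ (t = .typeII → q ≤ 1) ∧
      ∀ x ∈ unitWindow m, (if S.windowClass t Ω r x = P then (1 : ℝ) else 0) =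
        ∑ l, if ∀ i, x i ∈ Ico (a l i) (b l i) then 1 else 0 := by
  have hfin := S.finite_patchVecs t hΩ r
  set V := hfin.toFinset with hV
  have hmemV : ∀ {v}, v ∈ V ↔
      ∃ x ∈ unitWindow m, S.IsPatchVec t Ω r (latticeVec v (heightStep α x v)) :=
    hfin.mem_toFinset
  -- Only steps in `V` can enter a patch, so the pattern on `V` determines the class, and the
  -- acceptance domain is a union of pattern boxes.
  have hcongr : ∀ x ∈ unitWindow m, ∀ y ∈ unitWindow m, stepPattern α V x = stepPattern α V y →
      S.windowClass t Ω r x ⊆ S.windowClass t Ω r y := by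
    rintro x hx y hy h z ⟨v, h1, h2⟩
    have h3 : heightStep α x v = heightStep α y v := congrFun h ⟨v, hmemV.2 ⟨x, hx, h1⟩⟩
    rw [h3] at h1 h2
    exact ⟨v, h1, h2⟩
  have hcls : ∀ x ∈ unitWindow m, ∀ y ∈ unitWindow m, stepPattern α V x = stepPattern α V y →
      S.windowClass t Ω r x = S.windowClass t Ω r y := fun x hx y hy h =>
    (hcongr x hx y hy h).antisymm (hcongr y hy x hx h.symm)
  have hUfin : (stepPattern α V '' {x ∈ unitWindow m | S.windowClass t Ω r x = P}).Finite :=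
    (finite_range_stepPattern α V).subset (image_mono fun x hx => hx.1)
  set U := hUfin.toFinset with hU
  have hmemU : ∀ {u}, u ∈ U ↔
      u ∈ stepPattern α V '' {x ∈ unitWindow m | S.windowClass t Ω r x = P} := hUfin.mem_toFinset
  choose a b h0 hab h1 h using exists_box_of_stepPattern_eq α V
  set e := U.equivFin.symm with he
  refine ⟨U.card, fun l => a (e l), fun l => b (e l), fun l => h0 _, fun l => hab _, fun l => h1 _,
    ?_, fun x hx => ?_⟩
  -- For type II, whether a step is used depends on `v` alone, so every `v` in `V` occurs in every
  -- patch. As `π` is injective on the lattice, the class then determines the whole pattern.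
  · rintro rfl
    rw [Finset.card_le_one]
    intro u hu u' hu'
    obtain ⟨x, ⟨hx, hxP⟩, rfl⟩ := hmemU.1 hu
    obtain ⟨y, ⟨hy, hyP⟩, rfl⟩ := hmemU.1 hu'
    funext ⟨v, hv⟩
    obtain ⟨z, hz, hzv⟩ := hmemV.1 hv
    have hxv : S.IsPatchVec .typeII Ω r (latticeVec v (heightStep α x v)) := by
      simp only [IsPatchVec, rhoProj_apply] at hzv ⊢
      exact hzv
    have h2 : S.proj (latticeVec v (heightStep α x v)) ∈ S.windowClass .typeII Ω r y := by
      rw [hyP, ← hxP]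
      exact ⟨v, hxv, rfl⟩
    obtain ⟨v', _, h3⟩ := h2
    have h4 := S.injOn (mem_integerLattice.2 ⟨_, _, rfl⟩) (mem_integerLattice.2 ⟨_, _, rfl⟩) h3
    have h5 : v' = v := realVec_injective (congrArg Prod.fst h4)
    subst h5
    exact (realVec_injective (congrArg Prod.snd h4)).symm
  · have hsum : (∑ l, if ∀ i, x i ∈ Ico (a (e l) i) (b (e l) i) then (1 : ℝ) else 0) =
        ∑ u ∈ U, if stepPattern α V x = u then (1 : ℝ) else 0 := by
      rw [← Finset.sum_coe_sort U, ← Equiv.sum_comp e]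
      refine Finset.sum_congr rfl fun l _ => ?_
      simp only [h (e l) x hx]
    rw [hsum, Finset.sum_ite_eq]
    refine if_congr ?_ rfl rfl
    rw [hmemU]
    constructor
    · intro hP
      exact ⟨x, ⟨hx, hP⟩, rfl⟩
    · rintro ⟨y, ⟨hy, hyP⟩, hyx⟩
      rw [← hyP]
      exact hcls x hx y hy hyx.symm

end CubicalScheme

end Acceptance

/-! ### Frequencies and their rate of convergence -/

section Frequency

variable {d m : ℕ}

/-- A cut edge in direction `i` starts in the last layer of the cube or just before the first one,
and `N` times the size of a layer is the size of the cube. -/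
theorem card_cutEdges_gridCube_mul_le {ι : Type*} [Fintype ι] [DecidableEq ι]
    (Q : Finset (ι → ℤ)) (a : ι → ℤ) (N : ℕ) :
    (cutEdges Q (gridCube a N)).card * N ≤ 2 * Fintype.card ι * (gridCube a N).card := by
  set F : ι → ℤ → Finset (ι → ℤ) := fun i c =>
    Fintype.piFinset fun j => if j = i then {c} else Finset.Ico (a j) (a j + N) with hF
  have hcard : ∀ i c, (F i c).card * N = (gridCube a N).card := by
    intro i c
    rw [hF, card_gridCube, Fintype.card_piFinset, ← Finset.prod_erase_mul _ _ (Finset.mem_univ i)]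
    simp only [if_true, Finset.card_singleton, mul_one]
    rw [Finset.prod_congr rfl (g := fun _ => N) fun j hj => by
      simp [Finset.ne_of_mem_erase hj], Finset.prod_const,
      Finset.card_erase_of_mem (Finset.mem_univ i), Finset.card_univ, ← pow_succ,
      Nat.sub_add_cancel (Fintype.card_pos_iff.2 ⟨i⟩)]
  have hsub : cutEdges Q (gridCube a N) ⊆ Finset.univ.biUnion fun i =>
      (F i (a i + N - 1) ∪ F i (a i - 1)).image (Prod.mk i) := by
    rintro ⟨i, n⟩ h
    have h := (Finset.mem_filter.1 h).2.2
    simp only [Finset.mem_biUnion, Finset.mem_univ, true_and, Finset.mem_image, Finset.mem_union,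
      Prod.mk.injEq, hF, Fintype.mem_piFinset]
    refine ⟨i, n, ?_, rfl, rfl⟩
    have hoff : ∀ j, j ≠ i → (n + Pi.single i 1 : ι → ℤ) j = n j := fun j hj => by simp [hj]
    have hon : (n + Pi.single i 1 : ι → ℤ) i = n i + 1 := by simp
    by_cases hn : n ∈ gridCube a N
    · left
      have hn' := h.1 hn
      rw [mem_gridCube] at hn hn'
      intro j
      by_cases hj : j = i
      · subst hj
        simp only [if_true, Finset.mem_singleton]
        by_contra hne
        refine hn' fun l => ?_
        by_cases hl : l = j
        · subst hl
          have := hn l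
          rw [hon]
          omega
        · rw [hoff l hl]; exact hn l
      · rw [if_neg hj, Finset.mem_Ico]; exact hn j
    · right
      have hn' : n + Pi.single i 1 ∈ gridCube a N := by by_contra hc; exact hn (h.2 hc)
      rw [mem_gridCube] at hn hn'
      intro j
      by_cases hj : j = i
      · subst hj
        simp only [if_true, Finset.mem_singleton]
        by_contra hne
        refine hn fun l => ?_
        by_cases hl : l = j
        · subst hl
          have := hn' l
          rw [hon] at this
          omega
        · have := hn' l
          rwa [hoff l hl] at this
      · have := hn' j
        rw [if_neg hj, Finset.mem_Ico]
        rwa [hoff j hj] at this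
  calc _ ≤ (∑ i, ((F i (a i + N - 1)).card + (F i (a i - 1)).card)) * N := by
        refine Nat.mul_le_mul_right _ ((Finset.card_le_card hsub).trans
          (Finset.card_biUnion_le.trans (Finset.sum_le_sum fun i _ => ?_)))
        exact Finset.card_image_le.trans (Finset.card_union_le _ _)
    _ = 2 * Fintype.card ι * (gridCube a N).card := by
        simp only [Finset.sum_mul, add_mul, hcard, Finset.sum_const, Finset.card_univ, smul_eq_mul]
        ring

theorem finite_searchPoints {A : Set (TotalSpace d m)} (hA : Bornology.IsBounded A) :
    (searchPoints A).Finite := by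
  obtain ⟨R, hR⟩ := hA.exists_norm_le
  refine (finite_setOf_norm_realVec_le R).subset ?_
  rintro n ⟨x, hx, hxn⟩
  rw [mem_ofPred_eq]
  have h : realVec n = x.1 := hxn.symm
  rw [h]
  exact (le_max_left _ _).trans (hR x hx)

theorem latticeVec_mem_add_referenceSpace {A : Set (TotalSpace d m)} (v : Fin d → ℤ)
    (u : Fin m → ℤ) :
    latticeVec v u ∈ A + (referenceSpace d m : Set (TotalSpace d m)) ↔ v ∈ searchPoints A := by
  constructor
  · rintro ⟨x, hx, f, hf, h⟩
    refine ⟨x, hx, ?_⟩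
    have hf1 : f.1 = 0 := by
      have : f ∈ referenceSpace d m := hf
      simpa [referenceSpace] using this
    have := congrArg Prod.fst h
    simp only [Prod.fst_add, hf1, add_zero] at this
    exact this
  · rintro ⟨x, hx, hxv⟩
    refine ⟨x, hx, latticeVec v u - x, ?_, add_sub_cancel _ _⟩
    have hxv : x.1 = realVec v := hxv
    have : latticeVec v u - x ∈ referenceSpace d m := by
      simp [referenceSpace, latticeVec, hxv]
    exact this

theorem latticeVec_mem_box {R : ℝ} (hR : 0 ≤ R) (v : Fin d → ℤ) (u : Fin m → ℤ) :
    latticeVec v u ∈ {x : TotalSpace d m | ∀ i, x.1 i ∈ Icc (-R) R} ↔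
      v ∈ gridCube (fun _ => -(⌊R⌋₊ : ℤ)) (2 * ⌊R⌋₊ + 1) := by
  rw [mem_ofPred_eq, mem_gridCube]
  refine forall_congr' fun i => ?_
  simp only [latticeVec, realVec, mem_Icc]
  rw [Int.natCast_floor_eq_floor hR]
  have h1 : (-R ≤ v i) ↔ -v i ≤ ⌊R⌋ := by
    rw [Int.le_floor]; push_cast; exact neg_le
  rw [h1, ← Int.le_floor]
  push_cast
  rw [Int.natCast_floor_eq_floor hR]
  omega

namespace CubicalScheme

variable {α : Fin m → Fin d → ℝ} (S : CubicalScheme (linMap α))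

open Classical in
theorem abs_sum_windowClass_sub_le {t : PatchType} {Ω : Set (TotalSpace d m)} {r : ℝ}
    {P : Set (TotalSpace d m)} {C : ℝ}
    (hC : ∀ (w a b : Fin m → ℝ), (∀ i, 0 ≤ a i) →
      (∀ i, a i ≤ b i) → (∀ i, b i ≤ 1) → ∀ X : Finset (Fin d → ℤ), ∃ Q : Finset (Fin d → ℤ),
      |∑ n ∈ X, boxVisit α w a b n - X.card * ∏ i, (b i - a i)| ≤ C * (cutEdges Q X).card)
    {q : ℕ} {a b : Fin q → Fin m → ℝ} (h0 : ∀ l i, 0 ≤ a l i) (hab : ∀ l i, a l i ≤ b l i)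
    (h1 : ∀ l i, b l i ≤ 1)
    (h : ∀ x ∈ unitWindow m, (if S.windowClass t Ω r x = P then (1 : ℝ) else 0) =
        ∑ l, if ∀ i, x i ∈ Ico (a l i) (b l i) then 1 else 0)
    (s : TotalSpace d m) (n : Fin d → ℤ) (X : Finset (Fin d → ℤ)) {D : ℝ}
    (hD : ∀ Q, C * (cutEdges Q X).card ≤ D) :
    |(∑ v ∈ X, if S.windowClass t Ω r (windowPoint α s (n + v)) = P then (1 : ℝ) else 0) -
      X.card * ∑ l, ∏ i, (b l i - a l i)| ≤ q * D := by
  have e1 : ∀ v, (if S.windowClass t Ω r (windowPoint α s (n + v)) = P then (1 : ℝ) else 0) =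
      ∑ l, boxVisit α (orbitPoint α (orbitBase α s) n) (a l) (b l) v := by
    intro v
    rw [h (windowPoint α s (n + v)) fun i => ⟨Int.fract_nonneg _, Int.fract_lt_one _⟩]
    refine Finset.sum_congr rfl fun l _ => ?_
    rw [← boxVisit_add]
    rfl
  simp_rw [e1]
  rw [Finset.sum_comm, Finset.mul_sum, ← Finset.sum_sub_distrib]
  refine (Finset.abs_sum_le_sum_abs _ _).trans ?_
  refine (Finset.sum_le_sum (g := fun _ => D) fun l _ => ?_).trans ?_
  · obtain ⟨Q, hQ⟩ := hC (orbitPoint α (orbitBase α s) n) (a l) (b l) (h0 l) (hab l) (h1 l) X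
    exact hQ.trans (hD Q)
  · simp

/-- The frequency is the volume of the acceptance domain. Both search regions reduce to the same
discrepancy bound, applied to each of the `q` boxes. -/
theorem exists_frequency (hd : 1 ≤ d) {C : ℝ} (hC0 : 0 ≤ C)
    (hC : ∀ (w a b : Fin m → ℝ), (∀ i, 0 ≤ a i) →
      (∀ i, a i ≤ b i) → (∀ i, b i ≤ 1) → ∀ X : Finset (Fin d → ℤ), ∃ Q : Finset (Fin d → ℤ),
      |∑ n ∈ X, boxVisit α w a b n - X.card * ∏ i, (b i - a i)| ≤ C * (cutEdges Q X).card)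
    (t : PatchType) {Ω : Set (TotalSpace d m)} (hΩ : Bornology.IsBounded Ω) (r : ℝ)
    (P : Set (TotalSpace d m)) :
    ∃ (q : ℕ) (ξ : ℝ), (t = .typeII → q ≤ 1) ∧ S.IsFrequency t Ω r P ξ ∧
      ∀ s, S.IsRegular s → ∀ y ∈ S.cutProject s, ∀ A : Set (TotalSpace d m),
        Bornology.IsBounded A → (searchPoints A).Nonempty →
          |S.freqRegion s t Ω r P y A - ξ| ≤
            q * C * (boundaryArea (cubeComplex (searchPoints A)) / (searchPoints A).ncard) := by
  classical
  obtain ⟨q, a, b, h0, hab, h1, hq, h⟩ := S.exists_boxes_of_windowClass t hΩ r P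
  set ξ := ∑ l, ∏ i, (b l i - a l i) with hξ
  have key : ∀ s, S.IsRegular s → ∀ (n : Fin d → ℤ) (B : Set (TotalSpace d m))
      (X : Finset (Fin d → ℤ)), (∀ v u, latticeVec v u ∈ B ↔ v ∈ X) → X.Nonempty → ∀ D : ℝ,
      (∀ Q, C * (cutEdges Q X).card ≤ D) →
      |S.patchRatio s t Ω r P (S.proj (slicePoint α s n)) B - ξ| ≤ q * D / X.card := by
    intro s hs n B X hB hX D hD
    have hX0 : (0 : ℝ) < X.card := by exact_mod_cast hX.card_pos
    rw [S.patchRatio_eq hs t Ω r P n hB, le_div_iff₀ hX0, ← abs_of_pos hX0, ← abs_mul,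
      abs_of_pos hX0, sub_mul, div_mul_cancel₀ _ hX0.ne', mul_comm ξ]
    exact S.abs_sum_windowClass_sub_le hC h0 hab h1 h s n X hD
  refine ⟨q, ξ, hq, ?_, ?_⟩
  · intro s hs y hy
    rw [S.cutProject_eq_range hs] at hy
    obtain ⟨n, rfl⟩ := hy
    -- The integer points of `[-R, R]^d` form a cube of side `2⌊R⌋₊ + 1`, whose ratio of cut edges
    -- to points is `O(1/R)`.
    have hbound : ∀ᶠ R : ℝ in atTop, ‖S.freqBox s t Ω r P (S.proj (slicePoint α s n)) R - ξ‖ ≤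
        q * (C * (2 * d)) * (1 / ((⌊R⌋₊ : ℝ) + 1)) := by
      filter_upwards [eventually_ge_atTop (0 : ℝ)] with R hR
      set N := 2 * ⌊R⌋₊ + 1 with hN
      set X := gridCube (fun _ : Fin d => -(⌊R⌋₊ : ℤ)) N with hX
      have hXcard : X.card = N ^ d := by rw [hX, card_gridCube, Fintype.card_fin]
      have hX0 : 0 < X.card := by rw [hXcard]; positivity
      have hNr : (0 : ℝ) < N := by positivity
      have hD : ∀ Q, C * ((cutEdges Q X).card : ℝ) ≤ C * (2 * d * X.card / N) := by
        intro Q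
        refine mul_le_mul_of_nonneg_left ?_ hC0
        rw [le_div_iff₀ hNr]
        have := card_cutEdges_gridCube_mul_le Q (fun _ : Fin d => -(⌊R⌋₊ : ℤ)) N
        rw [Fintype.card_fin] at this
        exact_mod_cast this
      have hk := key s hs n _ X (latticeVec_mem_box hR) (Finset.card_pos.1 hX0) _ hD
      refine hk.trans ?_
      have hX0r : (X.card : ℝ) ≠ 0 := by exact_mod_cast hX0.ne'
      have e : (q : ℝ) * (C * (2 * d * X.card / N)) / X.card = q * (C * (2 * d)) * (1 / N) := by
        field_simp
      rw [e]
      refine mul_le_mul_of_nonneg_left ?_ (by positivity)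
      refine one_div_le_one_div_of_le (by positivity) ?_
      rw [hN]
      push_cast
      have : (0 : ℝ) ≤ ⌊R⌋₊ := by positivity
      linarith
    rw [← tendsto_sub_nhds_zero_iff]
    refine squeeze_zero_norm' hbound ?_
    rw [← mul_zero ((q : ℝ) * (C * (2 * d)))]
    exact (tendsto_one_div_add_atTop_nhds_zero_nat.comp tendsto_nat_floor_atTop).const_mul _
  · intro s hs y hy A hA hne
    rw [S.cutProject_eq_range hs] at hy
    obtain ⟨n, rfl⟩ := hy
    have hfin := finite_searchPoints hA
    have hX : (hfin.toFinset : Set (Fin d → ℤ)) = searchPoints A := hfin.coe_toFinset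
    have hk := key s hs n (A + (referenceSpace d m : Set (TotalSpace d m))) hfin.toFinset
      (fun v u => by rw [latticeVec_mem_add_referenceSpace, hfin.mem_toFinset])
      ((hfin.toFinset_nonempty).2 hne) (C * boundaryArea (cubeComplex (searchPoints A)))
      (fun Q => mul_le_mul_of_nonneg_left
        (by simpa only [hX] using card_cutEdges_le_boundaryArea hd Q hfin.toFinset) hC0)
    refine hk.trans (le_of_eq ?_)
    rw [ncard_eq_toFinset_card _ hfin]
    ring

end CubicalScheme

end Frequency

end

theorem theorem5 (d m : ℕ) (hd : 2 ≤ d) (hm : 0 < m) :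
    ∀ᵐ α : Fin m → Fin d → ℝ, ∀ S : CubicalScheme (linMap α),
      (∀ (t : PatchType) (Ω : Set (TotalSpace d m)) (r : ℝ), IsPatchShape (linMap α) Ω → 0 < r →
        ∀ P ∈ S.patchClasses t Ω r, ∃ ξ : ℝ, S.IsFrequency t Ω r P ξ ∧
          ∃ C : ℝ, ∀ s, S.IsRegular s → ∀ y ∈ S.cutProject s, ∀ A : Set (TotalSpace d m),
            A ⊆ (physicalSpace (linMap α) : Set (TotalSpace d m)) → Bornology.IsBounded A →
            (searchPoints A).Nonempty →
            |S.freqRegion s t Ω r P y A - ξ| ≤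
              C * (boundaryArea (cubeComplex (searchPoints A)) / (searchPoints A).ncard)) ∧
      (∃ C : ℝ, ∀ (Ω : Set (TotalSpace d m)) (r : ℝ), IsPatchShape (linMap α) Ω → 0 < r →
        ∀ P ∈ S.patchClasses .typeII Ω r, ∃ ξ : ℝ, S.IsFrequency .typeII Ω r P ξ ∧
          ∀ s, S.IsRegular s → ∀ y ∈ S.cutProject s, ∀ A : Set (TotalSpace d m),
            A ⊆ (physicalSpace (linMap α) : Set (TotalSpace d m)) → Bornology.IsBounded A →
            (searchPoints A).Nonempty →
            |S.freqRegion s .typeII Ω r P y A - ξ| ≤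
              C * (boundaryArea (cubeComplex (searchPoints A)) / (searchPoints A).ncard)) := by
  -- `C` is fixed before `S`. The type I constant is `q * C`, with `q` the number of boxes of the
  -- class; for type II, `q ≤ 1` leaves `C`.
  filter_upwards [ae_exists_discrepancy_le (m := m) hd] with α ⟨C, hC0, hC⟩ S
  refine ⟨fun t Ω r hΩ _ P _ => ?_, C, fun Ω r hΩ _ P _ => ?_⟩
  · obtain ⟨q, ξ, _, hξ, h⟩ := S.exists_frequency (by omega) hC0 hC t hΩ.2.1 r P
    exact ⟨ξ, hξ, q * C, fun s hs y hy A _ hA hne => h s hs y hy A hA hne⟩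
  · obtain ⟨q, ξ, hq, hξ, h⟩ := S.exists_frequency (by omega) hC0 hC .typeII hΩ.2.1 r P
    refine ⟨ξ, hξ, fun s hs y hy A _ hA hne => (h s hs y hy A hA hne).trans ?_⟩
    have hq1 : (q : ℝ) ≤ 1 := by exact_mod_cast hq rfl
    refine mul_le_mul_of_nonneg_right ?_ (div_nonneg ENNReal.toReal_nonneg (Nat.cast_nonneg _))
    exact mul_le_of_le_one_left hC0 hq1
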